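/- **Setting.** Let $\mathcal Z$ be a compact metric space, $\mu$ a Borel probability measure with support $\mathcal Z$, $n,p\ge 1$ and $\sigma_x,\sigma_y,\gamma\ge 0$. Let $z_1,\dots,z_n,z_{test}$ be i.i.d. with law $\mu$; let $\psi_1,\dots,\psi_p$ be (jointly measurable) real random functions on $\mathcal Z$; let $\mathbf e_1,\dots,\mathbf e_n,\mathbf e_{test}$ be i.i.d. random vectors in $\mathbb R^p$ with independent, zero-mean, unit-variance coordinates; let $\epsilon_1,\dots,\epsilon_n$ be i.i.d. with mean $0$ and variance $\sigma_y^2$. All of $z_i, z_{test},\psi_j,\mathbf e_i,\mathbf e_{test},\epsilon_i$ are mutually independent. Put $\mathbf X_{ij}=\psi_j(z_i)+\sigma_x\mathbf E_{ij}$, where $\mathbf E$ has rows $\mathbf e_i^\top$, and $y_i=g(z_i)+\epsilon_i$. Assume that $\mathbb E|\psi_j(z)|^2<\infty$ and $\lim_{z'\to z}\mathbb E|\psi_j(z)-\psi_j(z')|^2=0$ for all $j,z$, and that $\sup_{j,z}\mathbb E|\psi_j(z)|^4<\infty$ and $\sup_{i,j}\mathbb E|\mathbf E_{ij}|^4<\infty$.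 Let $\lambda_1\ge\lambda_2\ge\dots\ge0$ be the eigenvalues (with multiplicity, padded by zeros if only finitely many are nonzero) and $u_k$ corresponding $L_2(\mu)$-orthonormal eigenfunctions of the integral operator of the kernel $(z,z')\mapsto p^{-1}\sum_{j=1}^p\mathbb E[\psi_j(z)\psi_j(z')]$ on $L_2(\mu)$, and assume $\sum_k k\lambda_k<\infty$. Put $\phi(z)=(\lambda_k^{1/2}u_k(z))_{k\ge1}$, and assume $g(z)=\langle\phi(z),\theta^*\rangle_2$ for some $\theta^*\in\ell_2$ with $\theta^*_k=0$ whenever $\lambda_k=0$. Let $\boldsymbol\Phi$ be the matrix with rows $\phi(z_i)^\top$, $\mathbf K=\boldsymbol\Phi\boldsymbol\Phi^\top$, $\mathbf W_{jk}=(\lambda_kp)^{-1/2}\int\psi_ju_k\,d\mu$ ($\mathbf W_{jk}=0$ if $\lambda_k=0$), $\mathbf A=p^{-1}\mathbf X\mathbf X^\top+n\gamma\mathbf I_n$, $\hat\theta(\mathbf y)=\boldsymbol\Phi^\top\mathbf A^{-1}\mathbf y$, and $$\boldsymbol\Delta=\boldsymbol\Phi(\mathbf W^\top\mathbf W-\mathbf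 I)\boldsymbol\Phi^\top+p^{-1/2}\sigma_x(\boldsymbol\Phi\mathbf W^\top\mathbf E^\top+\mathbf E\mathbf W\boldsymbol\Phi^\top)+p^{-1}\sigma_x^2(\mathbf E\mathbf E^\top-p\mathbf I_n).$$ (All infinite sums are limits of partial sums; they converge almost surely.) Let $$S_1=\mathbb E_{z_{test},\boldsymbol\epsilon}|\phi(z_{test})^\top(\mathbf W^\top\mathbf W-\mathbf I)\hat\theta(\mathbf y)|^2,\quad S_2=\tfrac{\sigma_x^2}{p}\mathbb E_{z_{test},\boldsymbol\epsilon}|\phi(z_{test})^\top\mathbf W^\top\mathbf E^\top\mathbf A^{-1}\mathbf y|^2,\quad S_3=\tfrac{\sigma_x^2}{p^2}\mathbb E_{\mathbf e_{test},\boldsymbol\epsilon}|\mathbf e_{test}^\top\mathbf X^\top\mathbf A^{-1}\mathbf y|^2,$$ where the subscripted $\mathbb E$ is the conditional expectation given everything except the subscripted variables. Let $v_1=\sup_{z,z'}p^{-1}\sum_j\mathrm{Var}[\psi_j(z)\psi_j(z')]$ and $v_2=\sup_zp^{-1}\sum_j\mathbb E|\psi_j(z)|^2$. Write $\mu_n$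 for the smallest eigenvalue of a symmetric $n\times n$ matrix and $\|\cdot\|_2$ for the spectral norm, and let $C=\{2\|\boldsymbol\Delta\|_2\ge\mu_n(\mathbf K)+\sigma_x^2+n\gamma\}$ and $D=\{\mu_n(\mathbf K)+\sigma_x^2+n\gamma=0\}$. **Theorem.** For any $\delta_1,\delta_2,\delta_3>0$: (i) with probability at least $1-\sum_{i=1}^3\delta_i$, $$S_1+S_2+S_3\le\frac{n^2}{p}\left(\frac{v_1}{\delta_1}+\frac{\sigma_x^2v_2}{\delta_2}+\frac{\sigma_x^2(v_2+\sigma_x^2)}{\delta_3}\right)\frac{\sup_z|g(z)|^2+\sigma_y^2/n}{(\mu_n(p^{-1}\mathbf X\mathbf X^\top)+n\gamma)^2},$$ where the right-hand side is read as $+\infty$ if its denominator is zero (that is, if $\mathbf A$ is singular); (ii) with probability at least $1-\sum_{i=1}^3\delta_i-\mathbb P(C)-\mathbb P(D)$, the matrix $\mathbf A$ is invertible, $\mu_n(\mathbf K)+\sigma_x^2+n\gamma>0$, and $$S_1+S_2+S_3\le\frac{4n^2}{p}\left(\frac{v_1}{\delta_1}+\frac{\sigma_x^2v_2}{\delta_2}+\frac{\sigma_x^2(v_2+\sigma_x^2)}{\delta_3}\right)\frac{\sup_z|g(z)|^2+\sigma_y^2/n}{(\mu_n(\mathbf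 K)+\sigma_x^2+n\gamma)^2}.$$ -/

import Mathlib

open MeasureTheory ProbabilityTheory Filter Topology
open scoped ENNReal Matrix

noncomputable section

namespace LMM

/-- The sum of an infinite series of reals, as the limit of its partial sums in the given order. -/
def series (f : ℕ → ℝ) : ℝ :=
  limUnder atTop (fun N : ℕ => ∑ k ∈ Finset.range N, f k)

/-- The `k`-th largest eigenvalue (`1 ≤ k ≤ n`, counted with multiplicity) of a symmetric
`n × n` matrix. -/
def eigval {n : ℕ} (k : ℕ) (B : Matrix (Fin n) (Fin n) ℝ) : ℝ :=
  open Classical in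
  if h : B.IsHermitian ∧ 1 ≤ k ∧ k ≤ n then
    h.1.eigenvalues₀ ⟨k - 1, by rw [Fintype.card_fin]; omega⟩
  else 0

/-- The spectral norm of a square matrix. -/
def specNorm {n : ℕ} (B : Matrix (Fin n) (Fin n) ℝ) : ℝ :=
  ‖Matrix.toEuclideanCLM (n := Fin n) (𝕜 := ℝ) B‖

/-- Labels for the elementary sources of randomness. -/
inductive Source (n p : ℕ) : Type
  | latent (i : Fin n)
  | feature (j : Fin p)
  | noise (i : Fin n) (j : Fin p)
  | response (i : Fin n)
  | testLatent
  | testNoise (j : Fin p)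

/-- The ingredients of the latent metric model with `n` samples in dimension `p`, of the
response model, of ridge regression, and of the test point.  `ψ j z ω` is the value at `z` of the
`j`-th random function, and `mψ j` is the σ-algebra which carries the randomness of `ψ j`. -/
structure Model (Ω Z : Type*) [MeasurableSpace Z] (n p : ℕ) where
  μ : Measure Z
  z : Fin n → Ω → Z
  ψ : Fin p → Z → Ω → ℝ
  mψ : Fin p → MeasurableSpace Ω
  E : Fin n → Fin p → Ω → ℝ
  ε : Fin n → Ω → ℝ
  zTest : Ω → Z
  eTest : Fin p → Ω → ℝ
  g : Z → ℝ
  σx : ℝ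
  σy : ℝ
  γ : ℝ

namespace Model

variable {Ω Z : Type*} [MeasurableSpace Z] {n p : ℕ}

/-- The σ-algebra generated by one source of randomness. -/
@[reducible] def sigma (M : Model Ω Z n p) : Source n p → MeasurableSpace Ω
  | .latent i => MeasurableSpace.comap (M.z i) inferInstance
  | .feature j => M.mψ j
  | .noise i j => MeasurableSpace.comap (M.E i j) inferInstance
  | .response i => MeasurableSpace.comap (M.ε i) inferInstance
  | .testLatent => MeasurableSpace.comap M.zTest inferInstance
  | .testNoise j => MeasurableSpace.comap (M.eTest j) inferInstance

/-- The σ-algebra generated by everything except the sources in `T`. -/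
@[reducible] def sigmaExcept (M : Model Ω Z n p) (T : Set (Source n p)) : MeasurableSpace Ω :=
  ⨆ s ∈ Tᶜ, M.sigma s

/-- The distributional specification of the model. The random functions are jointly measurable
with respect to the σ-algebras `mψ j` that carry their randomness, so that evaluating them at an
independent random point makes sense. All sources are mutually independent; this includes mutual
independence of the random functions `ψ j`. -/
structure IsLMM [TopologicalSpace Z] [MeasurableSpace Ω] (M : Model Ω Z n p)
    (P : Measure Ω) : Prop where
  support_eq : M.μ.support = Set.univ
  z_meas : ∀ i, Measurable (M.z i)
  z_law : ∀ i, P.map (M.z i) = M.μ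
  zTest_meas : Measurable M.zTest
  zTest_law : P.map M.zTest = M.μ
  mψ_le : ∀ j, M.mψ j ≤ (inferInstance : MeasurableSpace Ω)
  ψ_meas : ∀ j, Measurable[(inferInstance : MeasurableSpace Z).prod (M.mψ j)]
    (fun q : Z × Ω => M.ψ j q.1 q.2)
  E_meas : ∀ i j, Measurable (M.E i j)
  eTest_meas : ∀ j, Measurable (M.eTest j)
  E_ident : ∀ i j, IdentDistrib (M.E i j) (M.eTest j) P P
  eTest_memLp : ∀ j, MemLp (M.eTest j) 2 P
  eTest_mean : ∀ j, ∫ ω, M.eTest j ω ∂P = 0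
  eTest_var : ∀ j, ∫ ω, M.eTest j ω ^ 2 ∂P = 1
  ε_meas : ∀ i, Measurable (M.ε i)
  ε_ident : ∀ i i', IdentDistrib (M.ε i) (M.ε i') P P
  ε_memLp : ∀ i, MemLp (M.ε i) 2 P
  ε_mean : ∀ i, ∫ ω, M.ε i ω ∂P = 0
  ε_var : ∀ i, ∫ ω, M.ε i ω ^ 2 ∂P = M.σy ^ 2
  σx_nonneg : 0 ≤ M.σx
  σy_nonneg : 0 ≤ M.σy
  γ_nonneg : 0 ≤ M.γ
  indep : iIndep M.sigma P

/-- Each random function is pointwise square integrable and mean-square continuous. -/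
def MeanSquareContinuous [TopologicalSpace Z] [MeasurableSpace Ω] (M : Model Ω Z n p)
    (P : Measure Ω) : Prop :=
  ∀ j, (∀ z, MemLp (M.ψ j z) 2 P) ∧
    ∀ z, Tendsto (fun z' => ∫ ω, (M.ψ j z ω - M.ψ j z' ω) ^ 2 ∂P) (𝓝 z) (𝓝 0)

/-- Uniformly bounded fourth moments of the random functions and of the noise. -/
def FourthMoments [MeasurableSpace Ω] (M : Model Ω Z n p) (P : Measure Ω) : Prop :=
  (∃ c : ℝ, ∀ j z, ∫⁻ ω, ‖M.ψ j z ω‖ₑ ^ 4 ∂P ≤ ENNReal.ofReal c) ∧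
  (∃ c : ℝ, ∀ i j, ∫⁻ ω, ‖M.E i j ω‖ₑ ^ 4 ∂P ≤ ENNReal.ofReal c)

/-- The implicit kernel. -/
def kernel [MeasurableSpace Ω] (M : Model Ω Z n p) (P : Measure Ω) (z z' : Z) : ℝ :=
  (p : ℝ)⁻¹ * ∑ j, ∫ ω, M.ψ j z ω * M.ψ j z' ω ∂P

/-- `lam` lists the eigenvalues of the integral operator of the implicit kernel on `L²(μ)` in
nonincreasing order with multiplicity (padded by zeros if there are finitely many nonzero ones),
and the `u k` with `lam k > 0` are corresponding orthonormal eigenfunctions: they are complete in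
the sense that the operator vanishes on their orthogonal complement. If `lam k = 0`, then `u k`
enters neither the feature map nor `W`, and nothing is required of it. -/
structure IsEigensystem [MeasurableSpace Ω] (M : Model Ω Z n p) (P : Measure Ω)
    (lam : ℕ → ℝ) (u : ℕ → Z → ℝ) : Prop where
  nonneg : ∀ k, 0 ≤ lam k
  antitone : Antitone lam
  memLp : ∀ k, 0 < lam k → MemLp (u k) 2 M.μ
  orthonormal : ∀ k l, 0 < lam k → 0 < lam l →
    ∫ z, u k z * u l z ∂M.μ = if k = l then 1 else 0
  eigen : ∀ k, 0 < lam k → ∀ z, ∫ z', M.kernel P z z' * u k z' ∂M.μ = lam k * u k z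
  complete : ∀ h : Z → ℝ, MemLp h 2 M.μ →
    (∀ k, 0 < lam k → ∫ z, h z * u k z ∂M.μ = 0) →
    ∀ᵐ z ∂M.μ, ∫ z', M.kernel P z z' * h z' ∂M.μ = 0

/-- The feature map `φ(z) = (lam_k^{1/2} u_k(z))_k`. -/
def feat (lam : ℕ → ℝ) (u : ℕ → Z → ℝ) (k : ℕ) (z : Z) : ℝ :=
  √(lam k) * u k z

/-- The regression function is `⟨φ(·), θ⟩` for a square summable `θ`, with `θ_k = 0` where
`lam_k = 0`. -/
def RegressionInRange (M : Model Ω Z n p) (lam : ℕ → ℝ) (u : ℕ → Z → ℝ) : Prop :=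
  ∃ θ : ℕ → ℝ, Summable (fun k => θ k ^ 2) ∧ (∀ k, lam k = 0 → θ k = 0) ∧
    ∀ z, HasSum (fun k => feat lam u k z * θ k) (M.g z)

/-- The entries of the random matrix `W`. -/
def W (M : Model Ω Z n p) (lam : ℕ → ℝ) (u : ℕ → Z → ℝ) (j : Fin p) (k : ℕ) (ω : Ω) : ℝ :=
  open Classical in
  if lam k = 0 then 0
  else (√(lam k * p))⁻¹ * ∫ z, M.ψ j z ω * u k z ∂M.μ

/-- The entries of the infinite matrix `WᵀW - I`. -/
def gramDev (M : Model Ω Z n p) (lam : ℕ → ℝ) (u : ℕ → Z → ℝ) (k l : ℕ) (ω : Ω) : ℝ :=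
  (∑ j, M.W lam u j k ω * M.W lam u j l ω) - if k = l then 1 else 0

/-- The bilinear form `aᵀ (WᵀW - I) b` for sequences `a`, `b`. -/
def gramForm (M : Model Ω Z n p) (lam : ℕ → ℝ) (u : ℕ → Z → ℝ) (a b : ℕ → ℝ) (ω : Ω) : ℝ :=
  series (fun k => a k * series (fun l => M.gramDev lam u k l ω * b l))

/-- The data matrix `X`, whose rows are `x_i = ψ(z_i) + σx e_i`. -/
def X (M : Model Ω Z n p) (ω : Ω) : Matrix (Fin n) (Fin p) ℝ :=
  Matrix.of fun i j => M.ψ j (M.z i ω) ω + M.σx * M.E i j ω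

/-- The noise matrix, whose rows are the `e_i`. -/
def Emat (M : Model Ω Z n p) (ω : Ω) : Matrix (Fin n) (Fin p) ℝ :=
  Matrix.of fun i j => M.E i j ω

/-- The responses `y_i = g(z_i) + ε_i`. -/
def y (M : Model Ω Z n p) (ω : Ω) : Fin n → ℝ :=
  fun i => M.g (M.z i ω) + M.ε i ω

/-- The matrix `p⁻¹ X Xᵀ`. -/
def covX (M : Model Ω Z n p) (ω : Ω) : Matrix (Fin n) (Fin n) ℝ :=
  (p : ℝ)⁻¹ • (M.X ω * (M.X ω)ᵀ)

/-- The matrix `A = p⁻¹ X Xᵀ + n γ I`. -/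
def A (M : Model Ω Z n p) (ω : Ω) : Matrix (Fin n) (Fin n) ℝ :=
  M.covX ω + ((n : ℝ) * M.γ) • (1 : Matrix (Fin n) (Fin n) ℝ)

/-- The kernel matrix `K = Φ Φᵀ`, where the rows of `Φ` are the `φ(z_i)`. -/
def K (M : Model Ω Z n p) (lam : ℕ → ℝ) (u : ℕ → Z → ℝ) (ω : Ω) : Matrix (Fin n) (Fin n) ℝ :=
  Matrix.of fun i i' => series (fun k => feat lam u k (M.z i ω) * feat lam u k (M.z i' ω))

/-- The vector `W φ(z)`. -/
def Wfeat (M : Model Ω Z n p) (lam : ℕ → ℝ) (u : ℕ → Z → ℝ) (z : Z) (ω : Ω) : Fin p → ℝ :=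
  fun j => series (fun k => feat lam u k z * M.W lam u j k ω)

/-- The matrix `Φ Wᵀ`. -/
def PhiWT (M : Model Ω Z n p) (lam : ℕ → ℝ) (u : ℕ → Z → ℝ) (ω : Ω) :
    Matrix (Fin n) (Fin p) ℝ :=
  Matrix.of fun i => M.Wfeat lam u (M.z i ω) ω

/-- The matrix
`Δ = Φ(WᵀW - I)Φᵀ + p^{-1/2} σx (Φ Wᵀ Eᵀ + E W Φᵀ) + p⁻¹ σx² (E Eᵀ - p I)`. -/
def Delta (M : Model Ω Z n p) (lam : ℕ → ℝ) (u : ℕ → Z → ℝ) (ω : Ω) :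
    Matrix (Fin n) (Fin n) ℝ :=
  (Matrix.of fun i i' => M.gramForm lam u (fun k => feat lam u k (M.z i ω))
      (fun k => feat lam u k (M.z i' ω)) ω)
  + ((√(p : ℝ))⁻¹ * M.σx) •
      (M.PhiWT lam u ω * (M.Emat ω)ᵀ + M.Emat ω * (M.PhiWT lam u ω)ᵀ)
  + ((p : ℝ)⁻¹ * M.σx ^ 2) •
      (M.Emat ω * (M.Emat ω)ᵀ - (p : ℝ) • (1 : Matrix (Fin n) (Fin n) ℝ))

/-- The vector `A⁻¹ y`. -/
def dual (M : Model Ω Z n p) (ω : Ω) : Fin n → ℝ :=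
  (M.A ω)⁻¹ *ᵥ M.y ω

/-- The coefficient sequence `Φᵀ A⁻¹ y`. -/
def thetaHat (M : Model Ω Z n p) (lam : ℕ → ℝ) (u : ℕ → Z → ℝ) (ω : Ω) : ℕ → ℝ :=
  fun k => ∑ i, feat lam u k (M.z i ω) * M.dual ω i

/-- The residual `S₁`: the conditional expectation, given everything except the test latent
variable and the response noise, of `|φ(zTest)ᵀ (WᵀW - I) θ̂(y)|²`. -/
def S₁ [MeasurableSpace Ω] (M : Model Ω Z n p) (P : Measure Ω)
    (lam : ℕ → ℝ) (u : ℕ → Z → ℝ) : Ω → ℝ≥0∞ :=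
  condLExp (M.sigmaExcept (insert .testLatent (Set.range .response))) P
    (fun ω => ‖M.gramForm lam u (fun k => feat lam u k (M.zTest ω)) (M.thetaHat lam u ω) ω‖ₑ ^ 2)

/-- The residual `S₂`: `σx² / p` times the conditional expectation, given everything except the
test latent variable and the response noise, of `|φ(zTest)ᵀ Wᵀ Eᵀ A⁻¹ y|²`. -/
def S₂ [MeasurableSpace Ω] (M : Model Ω Z n p) (P : Measure Ω)
    (lam : ℕ → ℝ) (u : ℕ → Z → ℝ) (ω : Ω) : ℝ≥0∞ :=
  ENNReal.ofReal (M.σx ^ 2 / p) *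
    condLExp (M.sigmaExcept (insert .testLatent (Set.range .response))) P
      (fun ω => ‖M.Wfeat lam u (M.zTest ω) ω ⬝ᵥ ((M.Emat ω)ᵀ *ᵥ M.dual ω)‖ₑ ^ 2) ω

/-- The residual `S₃`: `σx² / p²` times the conditional expectation, given everything except the
test noise and the response noise, of `|eTestᵀ Xᵀ A⁻¹ y|²`. -/
def S₃ [MeasurableSpace Ω] (M : Model Ω Z n p) (P : Measure Ω) (ω : Ω) : ℝ≥0∞ :=
  ENNReal.ofReal (M.σx ^ 2 / (p : ℝ) ^ 2) *
    condLExp (M.sigmaExcept (Set.range .testNoise ∪ Set.range .response)) P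
      (fun ω => ‖(fun j => M.eTest j ω) ⬝ᵥ ((M.X ω)ᵀ *ᵥ M.dual ω)‖ₑ ^ 2) ω

/-- `v₁ = sup_{z,z'} p⁻¹ ∑_j Var[ψ_j(z) ψ_j(z')]`. -/
def v₁ [MeasurableSpace Ω] (M : Model Ω Z n p) (P : Measure Ω) : ℝ :=
  ⨆ q : Z × Z, (p : ℝ)⁻¹ * ∑ j, variance (fun ω => M.ψ j q.1 ω * M.ψ j q.2 ω) P

/-- `v₂ = sup_z p⁻¹ ∑_j E|ψ_j(z)|²`. -/
def v₂ [MeasurableSpace Ω] (M : Model Ω Z n p) (P : Measure Ω) : ℝ :=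
  ⨆ z : Z, (p : ℝ)⁻¹ * ∑ j, ∫ ω, |M.ψ j z ω| ^ 2 ∂P

/-- The event `2 ‖Δ‖₂ ≥ μ_n(K) + σx² + n γ`. -/
def C (M : Model Ω Z n p) (lam : ℕ → ℝ) (u : ℕ → Z → ℝ) : Set Ω :=
  {ω | 2 * specNorm (M.Delta lam u ω) ≥ eigval n (M.K lam u ω) + M.σx ^ 2 + n * M.γ}

/-- The event `μ_n(K) + σx² + n γ = 0`. -/
def D (M : Model Ω Z n p) (lam : ℕ → ℝ) (u : ℕ → Z → ℝ) : Set Ω :=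
  {ω | eigval n (M.K lam u ω) + M.σx ^ 2 + n * M.γ = 0}

/-- `(n²/p) (v₁/δ₁ + σx² v₂/δ₂ + σx² (v₂ + σx²)/δ₃) (sup |g|² + σy²/n)`. -/
def boundNumerator [MeasurableSpace Ω] (M : Model Ω Z n p) (P : Measure Ω)
    (δ₁ δ₂ δ₃ : ℝ) : ℝ :=
  (n : ℝ) ^ 2 / p *
    (M.v₁ P / δ₁ + M.σx ^ 2 * M.v₂ P / δ₂ + M.σx ^ 2 * (M.v₂ P + M.σx ^ 2) / δ₃) *
    ((⨆ z, |M.g z| ^ 2) + M.σy ^ 2 / n)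

end Model

end LMM

end

/-! Up to fixed scalar factors, each of the three residuals is a conditional mean of `|rᵀ A⁻¹ y|²`
for a vector `r` that does not involve the response noise. In `S₁`, `r` is the deviation of the
empirical kernel `p⁻¹ ∑ ψ_j(zTest) ψ_j(z_i)` from its mean; in `S₂`, it is `p^{-1/2} E ψ(zTest)`; in
`S₃`, it is `X eTest`. Since `A` is measurable for the conditioning σ-algebra and `y = g(z) + ε`
with `ε` independent of the rest, integrating `ε` out gives the bound `‖A⁻¹‖² (n sup|g|² + σy²)`
times the conditional mean of `|r|²` (`condLExp_sq_residual_le`). The full means of the three `|r|²`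
are at most `n v₁ / p`, `n v₂` and `n p (v₂ + σx²)`, and Markov's inequality, used once for each
with its own `δ`, gives an event on which the residuals are controlled by `‖A⁻¹‖²`
(`exists_event_residual_le`).

Both claims then follow from a lower bound on the quadratic form of `A`. For (i) it is the smallest
eigenvalue of `p⁻¹ X Xᵀ` plus `nγ`. For (ii), almost surely `p⁻¹ X Xᵀ = K + σx² I + Δ` (`covX_eq`),
and outside `C` the perturbation `Δ` consumes at most half of `μ_n(K) + σx² + nγ`.

The analytic part passes from the infinite feature vectors to the functions `ψ_j`. The kernel
operator is `p⁻¹ ∑ T_j* T_j` with `T_j h = ∫ ψ_j h dμ`, so almost every path of `ψ_j` lies in the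
closed span of the eigenfunctions, and its `k`-th coefficient has second moment at most `p λ_k`.
Summability of `(k + 1) λ_k` makes the squared `L²` errors of the partial sums summable, hence the
expansion converges almost everywhere (`ae_tendsto_orthogonal_series`). Independence carries this
over to the random points `z_i` and `zTest`, where `W φ(z) = p^{-1/2} ψ(z)`. The same argument
applied to `kernel(z, ·)` gives Mercer's expansion, which identifies the mean in `S₁`. -/

set_option linter.unusedSectionVars false

namespace LMM

/-! ### Independence, conditional means and Markov's inequality. -/

section Probability

variable {Ω : Type*} [m0 : MeasurableSpace Ω] {P : Measure Ω}

lemma lintegral_comp_of_indepFun [IsProbabilityMeasure P] {α β : Type*} [MeasurableSpace α]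
    [MeasurableSpace β] {f : Ω → α} {g : Ω → β} (hf : Measurable f) (hg : Measurable g)
    (h : IndepFun f g P) {F : α × β → ℝ≥0∞} (hF : Measurable F) :
    ∫⁻ ω, F (f ω, g ω) ∂P = ∫⁻ ω, ∫⁻ ω', F (f ω, g ω') ∂P ∂P := by
  have h1 := (indepFun_iff_map_prod_eq_prod_map_map hf.aemeasurable hg.aemeasurable).1 h
  have : IsProbabilityMeasure (P.map g) := Measure.isProbabilityMeasure_map hg.aemeasurable
  rw [← lintegral_map hF (hf.prodMk hg), h1, lintegral_prod _ hF.aemeasurable,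
    lintegral_map hF.lintegral_prod_right' hf]
  exact lintegral_congr fun ω => lintegral_map (hF.comp measurable_prodMk_left) hg

/-- The identity maps from `Ω` to `(Ω, m1)` and to `(Ω, m2)` are independent random variables, so a
diagonal integral can be decoupled into a double one. -/
lemma lintegral_diag_of_indep {Ω : Type*} (m1 m2 : MeasurableSpace Ω) [m0 : MeasurableSpace Ω]
    {P : Measure Ω} [IsProbabilityMeasure P] (h1 : m1 ≤ m0) (h2 : m2 ≤ m0) (h : Indep m1 m2 P)
    {F : Ω × Ω → ℝ≥0∞} (hF : Measurable[m1.prod m2] F) :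
    ∫⁻ ω, F (ω, ω) ∂P = ∫⁻ ω, ∫⁻ ω', F (ω, ω') ∂P ∂P := by
  have hI : @IndepFun Ω Ω Ω m0 m1 m2 id id P := by
    refine (@IndepFun_iff_Indep Ω Ω Ω m0 m1 m2 id id P).2 ?_
    simpa only [MeasurableSpace.comap_id] using h
  exact @lintegral_comp_of_indepFun Ω m0 P _ Ω Ω m1 m2 id id (measurable_id'' h1)
    (measurable_id'' h2) hI F hF

/-- Expanding the square, the linear term dies because the `ξ i` are centred and the mixed products
because they are uncorrelated. -/
lemma lintegral_sq_add_sum [IsProbabilityMeasure P] {ι : Type*} [Fintype ι] {ξ : ι → Ω → ℝ} {s : ℝ}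
    (hL : ∀ i, MemLp (ξ i) 2 P) (hind : Pairwise fun i j => IndepFun (ξ i) (ξ j) P)
    (hmean : ∀ i, ∫ ω, ξ i ω ∂P = 0) (hvar : ∀ i, ∫ ω, ξ i ω ^ 2 ∂P = s) (c : ℝ) (b : ι → ℝ) :
    ∫⁻ ω, ENNReal.ofReal ((c + ∑ i, b i * ξ i ω) ^ 2) ∂P
      = ENNReal.ofReal (c ^ 2 + s * ∑ i, b i ^ 2) := by
  classical
  have hS : MemLp (fun ω => ∑ i, b i * ξ i ω) 2 P :=
    memLp_finsetSum _ fun i _ => (hL i).const_mul (b i)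
  have hI : Integrable (fun ω => ∑ i, b i * ξ i ω) P := hS.integrable (by norm_num)
  have hcS : MemLp (fun ω => c + ∑ i, b i * ξ i ω) 2 P := (memLp_const c).add hS
  have hm : ∫ ω, ∑ i, b i * ξ i ω ∂P = 0 := by
    rw [integral_finsetSum _ fun i _ => ((hL i).integrable (by norm_num)).const_mul _]
    simp [integral_const_mul, hmean]
  have hprod : ∀ i j, ∫ ω, ξ i ω * ξ j ω ∂P = if i = j then s else 0 := by
    intro i j
    split_ifs with hij
    · subst hij; simpa [sq] using hvar i
    · rw [(hind hij).integral_fun_mul_eq_mul_integral (hL i).1 (hL j).1, hmean]; simp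
  have hS2 : ∫ ω, (∑ i, b i * ξ i ω) ^ 2 ∂P = s * ∑ i, b i ^ 2 := by
    simp_rw [sq, Finset.sum_mul_sum]
    have hint : ∀ i j, Integrable (fun ω => b i * ξ i ω * (b j * ξ j ω)) P := fun i j =>
      ((hL i).const_mul (b i)).integrable_mul ((hL j).const_mul (b j))
    rw [integral_finsetSum _ fun i _ => integrable_finsetSum _ fun j _ => hint i j]
    simp_rw [integral_finsetSum _ fun j _ => hint _ j, mul_mul_mul_comm (b _) (ξ _ _),
      integral_const_mul, hprod]
    simp [Finset.mul_sum, mul_comm]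
  rw [← ofReal_integral_eq_lintegral_ofReal hcS.integrable_sq (ae_of_all _ fun _ => sq_nonneg _)]
  congr 1
  simp_rw [add_sq]
  have h1 : Integrable (fun ω => 2 * c * ∑ i, b i * ξ i ω) P := hI.const_mul _
  have h2 : Integrable (fun ω => c ^ 2 + 2 * c * ∑ i, b i * ξ i ω) P :=
    (integrable_const _).add h1
  rw [integral_add h2 hS.integrable_sq, integral_add (integrable_const _) h1, integral_const_mul,
    hm, hS2]
  simp

/-- On `m`-measurable sets the densities `condLExp m P ρ` and `ρ` define the same measure;
integrating the `m`-measurable `β` against it gives the pull-out rule without any finiteness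
assumption. -/
lemma lintegral_mul_condLExp {Ω : Type*} (m : MeasurableSpace Ω) [m0 : MeasurableSpace Ω]
    {P : Measure Ω} [IsProbabilityMeasure P] (hm : m ≤ m0) {β ρ : Ω → ℝ≥0∞} (hβ : Measurable[m] β) (hρ : Measurable ρ) :
    ∫⁻ ω, β ω * condLExp m P ρ ω ∂P = ∫⁻ ω, β ω * ρ ω ∂P := by
  have key : (P.withDensity (condLExp m P ρ)).trim hm = (P.withDensity ρ).trim hm := by
    refine @Measure.ext _ m _ _ fun s hs => ?_
    rw [trim_measurableSet_eq hm hs, trim_measurableSet_eq hm hs, withDensity_apply _ (hm s hs),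
      withDensity_apply _ (hm s hs), setLIntegral_condLExp hm P ρ hs]
  have h2 := congrArg (fun ν => ∫⁻ ω, β ω ∂ν) key
  simp only [lintegral_trim hm hβ] at h2
  rw [lintegral_withDensity_eq_lintegral_mul _ (measurable_condLExp' _ _ _) (hβ.mono hm le_rfl),
    lintegral_withDensity_eq_lintegral_mul _ hρ (hβ.mono hm le_rfl)] at h2
  simpa only [Pi.mul_apply, mul_comm] using h2

lemma measure_gt_div_le [IsProbabilityMeasure P] {R : Ω → ℝ≥0∞} (hR : Measurable R) {V δ : ℝ}
    (hδ : 0 < δ) (h : ∫⁻ ω, R ω ∂P ≤ ENNReal.ofReal V) :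
    P {ω | ENNReal.ofReal (V / δ) < R ω} ≤ ENNReal.ofReal δ := by
  have hsub : {ω | ENNReal.ofReal (V / δ) < R ω} ⊆ {ω | ENNReal.ofReal (V / δ) ≤ R ω} := by
    intro ω hω
    simp only [Set.mem_ofPred_eq] at *
    exact hω.le
  by_cases hV : 0 < V
  · refine (measure_mono hsub).trans ((meas_ge_le_lintegral_div hR.aemeasurable ?_ ENNReal.ofReal_ne_top).trans ?_)
    · simpa using div_pos hV hδ
    · refine (ENNReal.div_le_div_right h _).trans ?_
      rw [← ENNReal.ofReal_div_of_pos (div_pos hV hδ), div_div_cancel₀ hV.ne']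
  -- For `V ≤ 0` the threshold degenerates to zero and Markov says nothing; instead `R` vanishes
  -- almost everywhere, and the strict inequality makes the event null.
  · have h0 : ∫⁻ ω, R ω ∂P = 0 := by
      rwa [ENNReal.ofReal_of_nonpos (not_lt.1 hV), nonpos_iff_eq_zero] at h
    rw [lintegral_eq_zero_iff hR] at h0
    have : P {ω | ENNReal.ofReal (V / δ) < R ω} = 0 :=
      measure_mono_null (fun ω hω => (pos_of_gt (show _ < _ from hω)).ne') (ae_iff.1 h0)
    simp [this]

end Probability

/-! ### Spectral norm and smallest eigenvalue as bounds on quadratic forms. -/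

section Spectral

variable {n : ℕ}

lemma sq_dotProduct_mulVec_le (B : Matrix (Fin n) (Fin n) ℝ) (r w : Fin n → ℝ) :
    (r ⬝ᵥ (B *ᵥ w)) ^ 2 ≤ specNorm B ^ 2 * (∑ i, r i ^ 2) * ∑ i, w i ^ 2 := by
  have h1 := abs_real_inner_le_norm (WithLp.toLp 2 r : EuclideanSpace ℝ (Fin n))
    (Matrix.toEuclideanCLM (n := Fin n) (𝕜 := ℝ) B (WithLp.toLp 2 w))
  have h2 := (Matrix.toEuclideanCLM (n := Fin n) (𝕜 := ℝ) B).le_opNorm (WithLp.toLp 2 w)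
  have e1 : inner ℝ (WithLp.toLp 2 r : EuclideanSpace ℝ (Fin n))
      (Matrix.toEuclideanCLM (n := Fin n) (𝕜 := ℝ) B (WithLp.toLp 2 w)) = r ⬝ᵥ (B *ᵥ w) := by
    simp [EuclideanSpace.inner_eq_star_dotProduct, dotProduct_comm]
  have e2 : ∀ x : Fin n → ℝ, ‖(WithLp.toLp 2 x : EuclideanSpace ℝ (Fin n))‖ ^ 2 = ∑ i, x i ^ 2 := by
    intro x; simp [EuclideanSpace.norm_sq_eq]
  rw [e1] at h1
  rw [← e2, ← e2, ← sq_abs, ← mul_pow, ← mul_pow]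
  refine pow_le_pow_left₀ (abs_nonneg _) (h1.trans ?_) 2
  calc _ ≤ ‖(WithLp.toLp 2 r : EuclideanSpace ℝ (Fin n))‖ * _ :=
        mul_le_mul_of_nonneg_left h2 (norm_nonneg _)
    _ = _ := by rw [specNorm]; ring

lemma sum_sq_vecMul_le (B : Matrix (Fin n) (Fin n) ℝ) (r : Fin n → ℝ) :
    ∑ i, (r ᵥ* B) i ^ 2 ≤ specNorm B ^ 2 * ∑ i, r i ^ 2 := by
  -- Testing the bilinear bound on `w = Bᵀ r` gives `|Bᵀr|⁴ ≤ ‖B‖² |r|² |Bᵀr|²`; one factor `|Bᵀr|²`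
  -- is then cancelled.
  have h := sq_dotProduct_mulVec_le B r (r ᵥ* B)
  have e : r ⬝ᵥ (B *ᵥ (r ᵥ* B)) = ∑ i, (r ᵥ* B) i ^ 2 := by
    rw [Matrix.dotProduct_mulVec]; simp [dotProduct, sq]
  rw [e] at h
  have h0 : 0 ≤ ∑ i, (r ᵥ* B) i ^ 2 := Finset.sum_nonneg fun _ _ => sq_nonneg _
  rcases h0.eq_or_lt with h0 | h0
  · rw [← h0]; exact mul_nonneg (sq_nonneg _) (Finset.sum_nonneg fun _ _ => sq_nonneg _)
  · rw [sq] at h; exact le_of_mul_le_mul_right h h0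

lemma continuous_specNorm : Continuous (specNorm : Matrix (Fin n) (Fin n) ℝ → ℝ) := by
  have : Continuous fun B : Matrix (Fin n) (Fin n) ℝ =>
      Matrix.toEuclideanCLM (n := Fin n) (𝕜 := ℝ) B :=
    LinearMap.continuous_of_finiteDimensional
      ((Matrix.toEuclideanCLM (n := Fin n) (𝕜 := ℝ)).toAlgEquiv.toLinearMap)
  exact this.norm

lemma eigval_le_eigenvalues {B : Matrix (Fin n) (Fin n) ℝ} (hB : B.IsHermitian)
    (hn : 0 < n) (i : Fin n) : eigval n B ≤ hB.eigenvalues i := by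
  rw [eigval, dif_pos ⟨hB, hn, le_rfl⟩, Matrix.IsHermitian.eigenvalues]
  -- `eigenvalues₀` is nonincreasing and indexed from `0`, so `eigval n` sits at the last index `n -
  -- 1`.
  refine hB.eigenvalues₀_antitone ?_
  rw [Fin.le_def]
  have := ((Fintype.equivOfCardEq (Fintype.card_fin _)).symm i :
    Fin (Fintype.card (Fin n))).isLt
  have h2 := Fintype.card_fin n
  simp only
  omega

lemma eigval_mul_sum_sq_le {B : Matrix (Fin n) (Fin n) ℝ} (hB : B.IsHermitian) (hn : 0 < n)
    (x : Fin n → ℝ) : eigval n B * ∑ i, x i ^ 2 ≤ x ⬝ᵥ (B *ᵥ x) := by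
  have hle := eigval_le_eigenvalues hB hn
  set b := hB.eigenvectorBasis
  set w : EuclideanSpace ℝ (Fin n) := WithLp.toLp 2 x
  set c : Fin n → ℝ := fun j => inner ℝ (b j) w
  have hBc : ∀ j, inner ℝ (b j) (WithLp.toLp 2 (B *ᵥ x) : EuclideanSpace ℝ (Fin n)) =
      hB.eigenvalues j * c j := by
    intro j
    have h1 := hB.mulVec_eigenvectorBasis j
    have hT : Bᵀ = B := by simpa using hB.eq
    have : (B *ᵥ x) ⬝ᵥ (b j).ofLp = x ⬝ᵥ (B *ᵥ (b j).ofLp) := by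
      rw [Matrix.dotProduct_mulVec, ← Matrix.mulVec_transpose, hT]
    simp only [c, w, EuclideanSpace.inner_eq_star_dotProduct, star_trivial]
    rw [this, h1, dotProduct_smul, smul_eq_mul]
  have e1 : x ⬝ᵥ (B *ᵥ x) = ∑ j, hB.eigenvalues j * c j ^ 2 := by
    have h := b.sum_inner_mul_inner w (WithLp.toLp 2 (B *ᵥ x))
    simp_rw [hBc] at h
    have e : inner ℝ (WithLp.toLp 2 (B *ᵥ x)) w = x ⬝ᵥ (B *ᵥ x) := by
      simp [w, EuclideanSpace.inner_eq_star_dotProduct]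
    rw [← e, real_inner_comm, ← h]
    refine Finset.sum_congr rfl fun j _ => ?_
    simp only [c]
    rw [real_inner_comm w]
    ring
  have e2 : ∑ i, x i ^ 2 = ∑ j, c j ^ 2 := by
    have h := b.sum_inner_mul_inner w w
    have e : inner ℝ w w = ∑ i, x i ^ 2 := by
      rw [real_inner_self_eq_norm_sq, EuclideanSpace.real_norm_sq_eq]
    rw [← e, ← h]
    refine Finset.sum_congr rfl fun j _ => ?_
    rw [real_inner_comm, sq]
  rw [e1, e2, Finset.mul_sum]
  exact Finset.sum_le_sum fun j _ => mul_le_mul_of_nonneg_right (hle j) (sq_nonneg _)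

/-- Coercivity excludes a kernel vector. For `y = B⁻¹ w` it gives `c |y|² ≤ ⟨y, w⟩ ≤ |y| |w|`, hence
the norm bound; symmetry of `B` plays no role. -/
lemma isUnit_det_and_specNorm_inv_le {B : Matrix (Fin n) (Fin n) ℝ} {c : ℝ} (hc : 0 < c)
    (h : ∀ x : Fin n → ℝ, c * ∑ i, x i ^ 2 ≤ x ⬝ᵥ (B *ᵥ x)) :
    IsUnit B.det ∧ specNorm B⁻¹ ≤ c⁻¹ := by
  have hdet : IsUnit B.det := by
    rw [isUnit_iff_ne_zero]
    intro h0
    obtain ⟨v, hv, hv0⟩ := Matrix.exists_mulVec_eq_zero_iff.2 h0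
    have h1 := h v
    rw [hv0, dotProduct_zero] at h1
    have h2 : 0 < ∑ i, v i ^ 2 := by
      obtain ⟨i, hi⟩ := Function.ne_iff.1 hv
      exact Finset.sum_pos' (fun _ _ => sq_nonneg _) ⟨i, Finset.mem_univ _, by
        have : v i ≠ 0 := hi
        positivity⟩
    nlinarith [mul_pos hc h2]
  refine ⟨hdet, ContinuousLinearMap.opNorm_le_bound _ (inv_nonneg.2 hc.le) fun w => ?_⟩
  set y : Fin n → ℝ := B⁻¹ *ᵥ w.ofLp
  have hy : Matrix.toEuclideanCLM (n := Fin n) (𝕜 := ℝ) B⁻¹ w = WithLp.toLp 2 y := by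
    ext i; simp [y]
  have hBy : B *ᵥ y = w.ofLp := by
    simp [y, Matrix.mulVec_mulVec, Matrix.mul_nonsing_inv _ hdet]
  have h1 := h y
  rw [hBy] at h1
  have e2 : ∑ i, y i ^ 2 = ‖(WithLp.toLp 2 y : EuclideanSpace ℝ (Fin n))‖ ^ 2 := by
    simp [EuclideanSpace.norm_sq_eq]
  have h3 := abs_real_inner_le_norm w (WithLp.toLp 2 y : EuclideanSpace ℝ (Fin n))
  have e1 : inner ℝ w (WithLp.toLp 2 y : EuclideanSpace ℝ (Fin n)) = y ⬝ᵥ w.ofLp := by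
    simp [EuclideanSpace.inner_eq_star_dotProduct]
  rw [e1] at h3
  rw [hy, inv_mul_eq_div, le_div_iff₀ hc]
  rw [e2] at h1
  rcases (norm_nonneg (WithLp.toLp 2 y : EuclideanSpace ℝ (Fin n))).eq_or_lt with h0 | h0
  · rw [← h0]; simp
  · have := h1.trans ((le_abs_self _).trans h3)
    refine le_of_mul_le_mul_right ?_ h0
    nlinarith

end Spectral

/-! ### Integrating out the response noise. -/

section Residual

variable {n : ℕ}

lemma measurable_specNorm {α : Type*} [MeasurableSpace α] {B : α → Matrix (Fin n) (Fin n) ℝ}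
    (hB : ∀ i j, Measurable fun a => B a i j) : Measurable fun a => specNorm (B a) := by
  have hc : Continuous fun f : Fin n → Fin n → ℝ => specNorm (Matrix.of f) :=
    continuous_specNorm.comp continuous_id
  exact hc.measurable.comp (measurable_pi_iff.2 fun i => measurable_pi_iff.2 fun j => hB i j)

/-- The two variables range over separate measurable spaces so that two different sub-σ-algebras of
one `Ω` can be inserted. -/
lemma measurable_affine_sq {α β : Type*} [MeasurableSpace α] [MeasurableSpace β] {s : Set α}
    (hs : MeasurableSet s) {r h : α → Fin n → ℝ} {B : α → Matrix (Fin n) (Fin n) ℝ}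
    {ε : Fin n → β → ℝ} (hr : ∀ i, Measurable fun a => r a i) (hh : ∀ i, Measurable fun a => h a i)
    (hB : ∀ i j, Measurable fun a => B a i j) (hε : ∀ i, Measurable (ε i)) :
    Measurable fun q : α × β => s.indicator 1 q.1 *
      ENNReal.ofReal ((r q.1 ⬝ᵥ (B q.1 *ᵥ h q.1) + ∑ i, (r q.1 ᵥ* B q.1) i * ε i q.2) ^ 2) := by
  simp only [dotProduct, Matrix.mulVec, Matrix.vecMul]
  have h1 : Measurable fun q : α × β => (s.indicator 1 q.1 : ℝ≥0∞) :=
    (measurable_one.indicator hs).comp measurable_fst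
  have hr' : ∀ i, Measurable fun q : α × β => r q.1 i := fun i => (hr i).comp measurable_fst
  have hh' : ∀ i, Measurable fun q : α × β => h q.1 i := fun i => (hh i).comp measurable_fst
  have hB' : ∀ i j, Measurable fun q : α × β => B q.1 i j := fun i j =>
    (hB i j).comp measurable_fst
  have hε' : ∀ i, Measurable fun q : α × β => ε i q.2 := fun i => (hε i).comp measurable_snd
  fun_prop

/-- The conditional mean square of `rᵀ B (h + ε)` for noise `ε` which is independent of
everything else. -/
lemma condLExp_sq_residual_le {Ω : Type*} (m 𝒢 mε : MeasurableSpace Ω) [m0 : MeasurableSpace Ω]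
    {P : Measure Ω} [IsProbabilityMeasure P] (hm : m ≤ 𝒢) (h𝒢 : 𝒢 ≤ m0) (hmε : mε ≤ m0)
    (hind : Indep 𝒢 mε P) {r h : Ω → Fin n → ℝ} {B : Ω → Matrix (Fin n) (Fin n) ℝ}
    {ε : Fin n → Ω → ℝ} (hr : ∀ i, Measurable[𝒢] fun ω => r ω i)
    (hh : ∀ i, Measurable[𝒢] fun ω => h ω i) (hB : ∀ i j, Measurable[m] fun ω => B ω i j)
    (hε : ∀ i, Measurable[mε] (ε i)) {G s : ℝ} (hG : ∀ ω i, h ω i ^ 2 ≤ G) (hs : 0 ≤ s)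
    (hL : ∀ i, MemLp (ε i) 2 P) (hpair : Pairwise fun i j => IndepFun (ε i) (ε j) P)
    (hmean : ∀ i, ∫ ω, ε i ω ∂P = 0) (hvar : ∀ i, ∫ ω, ε i ω ^ 2 ∂P = s) :
    condLExp m P (fun ω => ‖r ω ⬝ᵥ (B ω *ᵥ (h ω + fun i => ε i ω))‖ₑ ^ 2) ≤ᵐ[P]
      fun ω => ENNReal.ofReal (specNorm (B ω) ^ 2 * (n * G + s)) *
        condLExp m P (fun ω => ENNReal.ofReal (∑ i, r ω i ^ 2)) ω := by
  have hm0 : m ≤ m0 := hm.trans h𝒢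
  set β : Ω → ℝ≥0∞ := fun ω => ENNReal.ofReal (specNorm (B ω) ^ 2 * (n * G + s)) with hβdef
  set ρ : Ω → ℝ≥0∞ := fun ω => ENNReal.ofReal (∑ i, r ω i ^ 2) with hρdef
  have hβ : Measurable[m] β := by
    have := @measurable_specNorm n Ω m B hB
    exact ((this.pow_const 2).mul_const _).ennreal_ofReal
  have hρ : Measurable ρ :=
    (Finset.measurable_sum _ fun i _ => ((hr i).mono h𝒢 le_rfl).pow_const 2).ennreal_ofReal
  have hR := measurable_condLExp m P ρ
  refine ae_le_of_ae_le_trim (hm := hm0) ?_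
  -- Both sides are `m`-measurable, so it suffices to compare their integrals over sets of `m`.
  -- There conditioning disappears on the left, and on the right after pulling out the
  -- `m`-measurable factor.
  refine @ae_le_of_forall_setLIntegral_le_of_sigmaFinite Ω m (P.trim hm0) _ _ _
    (measurable_condLExp _ _ _) fun t ht _ => ?_
  rw [setLIntegral_trim hm0 (measurable_condLExp _ _ _) ht, setLIntegral_condLExp hm0 P _ ht,
    show ∫⁻ ω in t, ENNReal.ofReal (specNorm (B ω) ^ 2 * (n * G + s)) * condLExp m P ρ ω
      ∂P.trim hm0 = ∫⁻ ω in t, β ω * condLExp m P ρ ω ∂P from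
      setLIntegral_trim hm0 (hβ.mul hR) ht]
  have hti : Measurable[m] (t.indicator (1 : Ω → ℝ≥0∞)) :=
    (@measurable_const ℝ≥0∞ Ω _ m 1).indicator ht
  have hind1 : ∀ f : Ω → ℝ≥0∞, ∫⁻ ω in t, f ω ∂P = ∫⁻ ω, t.indicator 1 ω * f ω ∂P := by
    intro f
    rw [← lintegral_indicator (hm0 t ht)]
    refine lintegral_congr fun ω => ?_
    by_cases hω : ω ∈ t <;> simp [hω]
  rw [hind1, hind1]
  have e1 : ∀ ω, t.indicator (1 : Ω → ℝ≥0∞) ω * (β ω * condLExp m P ρ ω) =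
      (t.indicator (1 : Ω → ℝ≥0∞) ω * β ω) * condLExp m P ρ ω := fun ω => (mul_assoc _ _ _).symm
  simp_rw [e1]
  rw [lintegral_mul_condLExp m hm0 (β := fun ω => t.indicator (1 : Ω → ℝ≥0∞) ω * β ω)
    (hti.mul hβ) hρ]
  set F : Ω × Ω → ℝ≥0∞ := fun q => t.indicator 1 q.1 * ENNReal.ofReal
    ((r q.1 ⬝ᵥ (B q.1 *ᵥ h q.1) + ∑ i, (r q.1 ᵥ* B q.1) i * ε i q.2) ^ 2) with hF
  have hFm : Measurable[𝒢.prod mε] F :=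
    @measurable_affine_sq n Ω Ω 𝒢 mε t (hm t ht) r h B ε hr hh
      (fun i j => (hB i j).mono hm le_rfl) hε
  have e2 : ∀ ω, t.indicator (1 : Ω → ℝ≥0∞) ω * ‖r ω ⬝ᵥ (B ω *ᵥ (h ω + fun i => ε i ω))‖ₑ ^ 2 =
      F (ω, ω) := by
    intro ω
    simp only [hF]
    congr 1
    rw [Real.enorm_eq_ofReal_abs, ← ENNReal.ofReal_pow (abs_nonneg _), sq_abs, Matrix.mulVec_add,
      dotProduct_add, Matrix.dotProduct_mulVec (r ω) (B ω) (fun i => ε i ω)]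
    rfl
  simp_rw [e2]
  -- The noise becomes an independent copy; with all else frozen, `rᵀB(h + ε)` is affine in `ε` and
  -- its mean square is `(rᵀBh)² + s |Bᵀr|²`.
  rw [lintegral_diag_of_indep 𝒢 mε h𝒢 hmε hind hFm]
  refine lintegral_mono fun ω => ?_
  simp only [hF]
  rw [lintegral_const_mul', mul_assoc]
  swap
  · by_cases hω : ω ∈ t <;> simp [hω]
  gcongr
  rw [lintegral_sq_add_sum hL hpair hmean hvar, hβdef, hρdef]
  simp only
  rw [← ENNReal.ofReal_mul']
  swap
  · exact Finset.sum_nonneg fun _ _ => sq_nonneg _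
  refine ENNReal.ofReal_le_ofReal ?_
  have h1 := sq_dotProduct_mulVec_le (B ω) (r ω) (h ω)
  have h2 := sum_sq_vecMul_le (B ω) (r ω)
  have h3 : ∑ i, h ω i ^ 2 ≤ n * G := by
    calc ∑ i, h ω i ^ 2 ≤ ∑ _i : Fin n, G := Finset.sum_le_sum fun i _ => hG ω i
      _ = n * G := by simp
  have h4 : 0 ≤ specNorm (B ω) ^ 2 * ∑ i, r ω i ^ 2 :=
    mul_nonneg (sq_nonneg _) (Finset.sum_nonneg fun _ _ => sq_nonneg _)
  nlinarith [mul_le_mul_of_nonneg_left h3 h4, mul_le_mul_of_nonneg_left h2 hs]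

end Residual

/-! ### Orthogonal expansions in a Hilbert space. -/

section Hilbert

variable {H : Type*} [NormedAddCommGroup H] [InnerProductSpace ℝ H] [CompleteSpace H]

/-- Expansion of a vector which is orthogonal to the orthogonal complement of an orthogonal system
of vectors of length `0` or `1`, with the mean square error of the partial sums. -/
lemma norm_sq_sub_partial_sum {v : ℕ → H} (hv : ∀ k l, k ≠ l → inner ℝ (v k) (v l) = 0)
    (hv1 : ∀ k, v k = 0 ∨ ‖v k‖ = 1) {f : H}
    (hf : ∀ h : H, (∀ k, inner ℝ h (v k) = 0) → inner ℝ f h = 0)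
    (hc : Summable fun k => inner ℝ f (v k) ^ 2) (N : ℕ) :
    ‖f - ∑ k ∈ Finset.range N, inner ℝ f (v k) • v k‖ ^ 2 = ∑' k, inner ℝ f (v (k + N)) ^ 2 := by
  classical
  set c : ℕ → ℝ := fun k => inner ℝ f (v k)
  have hin : ∀ k l, inner ℝ (c k • v k) (v l) = if k = l then c l else 0 := by
    intro k l
    rw [real_inner_smul_left]
    split_ifs with h
    · subst h
      rcases hv1 k with h0 | h1
      · simp [c, h0]
      · rw [real_inner_self_eq_norm_sq, h1]; simp
    · rw [hv k l h, mul_zero]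
  have hsum : ∀ t : Finset ℕ, ‖∑ k ∈ t, c k • v k‖ ^ 2 = ∑ k ∈ t, c k ^ 2 := by
    intro t
    rw [← real_inner_self_eq_norm_sq, inner_sum]
    refine Finset.sum_congr rfl fun l hl => ?_
    rw [real_inner_smul_right, sum_inner]
    simp only [hin]
    simp [hl, sq]
  -- Orthogonality turns the Cauchy criterion for `∑ c_k v_k` into the one for `∑ c_k²`.
  have hS : Summable fun k => c k • v k := by
    rw [summable_iff_vanishing_norm]
    intro e he
    obtain ⟨s, hs⟩ := summable_iff_vanishing_norm.1 hc (e ^ 2) (by positivity)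
    refine ⟨s, fun t ht => ?_⟩
    have h1 := hs t ht
    rw [← hsum t, Real.norm_of_nonneg (sq_nonneg _)] at h1
    exact lt_of_pow_lt_pow_left₀ 2 he.le h1
  set g := ∑' k, c k • v k
  have hg : Tendsto (fun N => ∑ k ∈ Finset.range N, c k • v k) atTop (𝓝 g) :=
    hS.hasSum.tendsto_sum_nat
  have hgv : ∀ l, inner ℝ g (v l) = c l := by
    intro l
    have h1 : Tendsto (fun N => inner ℝ (∑ k ∈ Finset.range N, c k • v k) (v l)) atTop
        (𝓝 (inner ℝ g (v l))) := hg.inner tendsto_const_nhds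
    refine tendsto_nhds_unique h1 (tendsto_const_nhds.congr' ?_)
    filter_upwards [eventually_gt_atTop l] with N hN
    rw [sum_inner]
    simp [hin, hN]
  have hd : ∀ k, inner ℝ (f - g) (v k) = 0 := by
    intro k; rw [inner_sub_left, hgv]; simp [c]
  have hfd : inner ℝ f (f - g) = 0 := hf _ hd
  have hgd : inner ℝ g (f - g) = 0 := by
    have h1 : Tendsto (fun N => inner ℝ (∑ k ∈ Finset.range N, c k • v k) (f - g)) atTop
        (𝓝 (inner ℝ g (f - g))) := hg.inner tendsto_const_nhds
    refine tendsto_nhds_unique h1 (tendsto_const_nhds.congr fun N => ?_)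
    rw [sum_inner]
    symm
    refine Finset.sum_eq_zero fun k _ => ?_
    rw [real_inner_smul_left, real_inner_comm, hd, mul_zero]
  -- The difference `f - g` is orthogonal to every `v k`, hence to `f` by `hf` and to `g` as a limit
  -- of combinations of the `v k`.
  have hfg : f = g := by
    have : inner ℝ (f - g) (f - g) = 0 := by rw [inner_sub_left, hfd, hgd, sub_zero]
    exact sub_eq_zero.1 (inner_self_eq_zero.1 this)
  have h2 : Tendsto (fun M => ‖∑ k ∈ Finset.range M, c k • v k -
      ∑ k ∈ Finset.range N, c k • v k‖ ^ 2) atTop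
      (𝓝 (‖f - ∑ k ∈ Finset.range N, c k • v k‖ ^ 2)) := by
    rw [hfg]; exact ((hg.sub_const _).norm).pow 2
  have h3 : Tendsto (fun M => ∑ k ∈ Finset.range M, c (k + N) ^ 2) atTop
      (𝓝 (∑' k, c (k + N) ^ 2)) :=
    ((summable_nat_add_iff N).2 hc).hasSum.tendsto_sum_nat
  refine tendsto_nhds_unique (h2.comp (tendsto_add_atTop_nat N)) (h3.congr fun M => ?_)
  simp only [Function.comp]
  have e : ∑ k ∈ Finset.range (M + N), c k • v k - ∑ k ∈ Finset.range N, c k • v k =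
      ∑ k ∈ Finset.Ico N (M + N), c k • v k := by
    rw [Finset.sum_Ico_eq_sub _ (Nat.le_add_left N M)]
  rw [e, hsum, Finset.sum_Ico_eq_sum_range]
  simp [add_comm]

/-- By Tonelli, `a j` is counted once for each `N` in `0, …, j`, which is `j + 1` times. -/
lemma summable_tail_sums {a : ℕ → ℝ} (ha : ∀ k, 0 ≤ a k)
    (h : Summable fun k : ℕ => ((k : ℝ) + 1) * a k) : Summable fun N => ∑' k, a (k + N) := by
  have ha1 : Summable a := h.of_nonneg_of_le ha fun k => by
    nlinarith [ha k, (Nat.cast_nonneg k : (0 : ℝ) ≤ k), mul_nonneg (Nat.cast_nonneg k) (ha k)]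
  have key : ∑' N, ∑' k, ENNReal.ofReal (a (k + N)) ≠ ∞ := by
    have e : ∀ N, ∑' k, ENNReal.ofReal (a (k + N)) =
        ∑' j, if N ≤ j then ENNReal.ofReal (a j) else 0 := by
      intro N
      rw [← Summable.sum_add_tsum_nat_add' (k := N) (f := fun j => if N ≤ j then
        ENNReal.ofReal (a j) else 0) ENNReal.summable, Finset.sum_eq_zero, zero_add]
      · simp
      · intro i hi; simp at hi; simp [hi]
    simp_rw [e]
    rw [ENNReal.tsum_comm]
    have e2 : ∀ j : ℕ, ∑' N, (if N ≤ j then ENNReal.ofReal (a j) else 0) =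
        ENNReal.ofReal (((j : ℝ) + 1) * a j) := by
      intro j
      rw [tsum_eq_sum (s := Finset.range (j + 1)) (by intro b hb; simp at hb; simp; omega)]
      rw [Finset.sum_congr rfl fun i hi => if_pos (by simp at hi; omega)]
      rw [ENNReal.ofReal_mul (by positivity)]
      rw [ENNReal.ofReal_add (by positivity) zero_le_one]
      simp
    simp_rw [e2]
    exact h.tsum_ofReal_ne_top
  have e3 : ∀ N, ∑' k, ENNReal.ofReal (a (k + N)) = ENNReal.ofReal (∑' k, a (k + N)) := fun N =>
    (ENNReal.ofReal_tsum_of_nonneg (fun k => ha _) ((summable_nat_add_iff N).2 ha1)).symm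
  simp_rw [e3] at key
  have := ENNReal.summable_toReal key
  refine this.congr fun N => ?_
  rw [ENNReal.toReal_ofReal (tsum_nonneg fun k => ha _)]

end Hilbert

/-! ### Almost everywhere convergence of orthogonal series in `L²`. -/

section SquareIntegrable

variable {Z : Type*} [MeasurableSpace Z] {μ : Measure Z}

lemma inner_toLp {f g : Z → ℝ} (hf : MemLp f 2 μ) (hg : MemLp g 2 μ) :
    inner ℝ hf.toLp hg.toLp = ∫ z, f z * g z ∂μ := by
  rw [L2.inner_def]
  refine integral_congr_ae ?_
  filter_upwards [hf.coeFn_toLp, hg.coeFn_toLp] with z h1 h2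
  rw [h1, h2]
  simp [mul_comm]

/-- An orthogonal series of square integrable functions with `∑ (k + 1) c_k² < ∞` converges almost
everywhere, to the function which it represents in mean square. -/
lemma ae_tendsto_orthogonal_series {v : ℕ → Z → ℝ} (hv : ∀ k, MemLp (v k) 2 μ)
    (horth : ∀ k l, k ≠ l → ∫ z, v k z * v l z ∂μ = 0)
    (hone : ∀ k, v k = 0 ∨ ∫ z, v k z * v k z ∂μ = 1) {f : Z → ℝ} (hf : MemLp f 2 μ)
    (hspan : ∀ h : Z → ℝ, MemLp h 2 μ → (∀ k, ∫ z, h z * v k z ∂μ = 0) → ∫ z, f z * h z ∂μ = 0)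
    (hc : Summable fun k : ℕ => ((k : ℝ) + 1) * (∫ z, f z * v k z ∂μ) ^ 2) :
    ∀ᵐ z ∂μ, Tendsto (fun N => ∑ k ∈ Finset.range N, (∫ z, f z * v k z ∂μ) * v k z) atTop
      (𝓝 (f z)) := by
  set c : ℕ → ℝ := fun k => ∫ z, f z * v k z ∂μ
  set V : ℕ → Lp ℝ 2 μ := fun k => (hv k).toLp
  set F : Lp ℝ 2 μ := hf.toLp
  have hcV : ∀ k, inner ℝ F (V k) = c k := fun k => inner_toLp hf (hv k)
  have hc1 : Summable fun k => c k ^ 2 := hc.of_nonneg_of_le (fun k => sq_nonneg _) fun k => by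
    have := mul_nonneg (Nat.cast_nonneg k : (0 : ℝ) ≤ k) (sq_nonneg (c k))
    simp only [c] at *
    linarith
  have key : ∀ N, ‖F - ∑ k ∈ Finset.range N, c k • V k‖ ^ 2 = ∑' k, c (k + N) ^ 2 := by
    intro N
    have := norm_sq_sub_partial_sum (v := V) (f := F)
      (fun k l hkl => (inner_toLp (hv k) (hv l)).trans (horth k l hkl)) ?_ ?_ ?_ N
    · simpa only [hcV] using this
    · intro k
      rcases hone k with h | h
      · left
        simp only [V, h]
        exact MemLp.toLp_zero _
      · right
        have h2 := inner_toLp (hv k) (hv k)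
        rw [h, real_inner_self_eq_norm_sq] at h2
        exact (pow_eq_one_iff_of_nonneg (norm_nonneg _) two_ne_zero).1 h2
    · intro h hh
      have hm := Lp.memLp h
      have e : h = hm.toLp := (Lp.toLp_coeFn h hm).symm
      rw [e]
      refine (inner_toLp hf hm).trans (hspan _ hm fun k => ?_)
      rw [← inner_toLp hm (hv k), ← e]
      exact hh k
    · simpa only [hcV] using hc1
  have hS : ∀ N, MemLp (fun z => f z - ∑ k ∈ Finset.range N, c k * v k z) 2 μ := fun N =>
    hf.sub (memLp_finsetSum _ fun k _ => (hv k).const_mul _)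
  have key2 : ∀ N, ∫ z, (f z - ∑ k ∈ Finset.range N, c k * v k z) ^ 2 ∂μ =
      ∑' k, c (k + N) ^ 2 := by
    intro N
    have e : F - ∑ k ∈ Finset.range N, c k • V k = (hS N).toLp := by
      refine Lp.ext ?_
      have h3 : ∀ N, ⇑(∑ k ∈ Finset.range N, c k • V k) =ᵐ[μ]
          fun z => ∑ k ∈ Finset.range N, c k * v k z := by
        intro N
        induction N with
        | zero =>
          simp only [Finset.range_zero, Finset.sum_empty]
          exact Lp.coeFn_zero ℝ 2 μ
        | succ N ih =>
          rw [Finset.sum_range_succ]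
          filter_upwards [ih, Lp.coeFn_add (∑ k ∈ Finset.range N, c k • V k) (c N • V N),
            Lp.coeFn_smul (c N) (V N), (hv N).coeFn_toLp] with z h1 h2 h3 h4
          rw [h2, Pi.add_apply, h1, h3, Finset.sum_range_succ, Pi.smul_apply, h4, smul_eq_mul]
      filter_upwards [h3 N, Lp.coeFn_sub F (∑ k ∈ Finset.range N, c k • V k), hf.coeFn_toLp,
        (hS N).coeFn_toLp] with z h1 h2 h4 h5
      rw [h2, h5, Pi.sub_apply, h1, h4]
    rw [← key N, e, ← real_inner_self_eq_norm_sq, inner_toLp]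
    simp_rw [sq]
  have hsum := summable_tail_sums (fun k => sq_nonneg (c k)) hc
  -- The squared `L²` errors are the tail sums of `c_k²`, which are summable in `N`. Thus `∑_N (f -
  -- S_N)²` is finite almost everywhere, and its terms tend to zero there.
  have hint : ∫⁻ z, ∑' N, ENNReal.ofReal ((f z - ∑ k ∈ Finset.range N, c k * v k z) ^ 2) ∂μ
      ≠ ∞ := by
    rw [lintegral_tsum fun N => ((hS N).1.aemeasurable.pow_const 2).ennreal_ofReal]
    simp_rw [← ofReal_integral_eq_lintegral_ofReal (hS _).integrable_sq
      (ae_of_all _ fun _ => sq_nonneg _), key2]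
    exact hsum.tsum_ofReal_ne_top
  have hae := ae_lt_top' (AEMeasurable.tsum fun N =>
    ((hS N).1.aemeasurable.pow_const 2).ennreal_ofReal) hint
  filter_upwards [hae] with z hz
  have h1 := ENNReal.summable_toReal hz.ne
  simp_rw [ENNReal.toReal_ofReal (sq_nonneg _)] at h1
  have h2 := h1.tendsto_atTop_zero
  have h3 : Tendsto (fun N => f z - ∑ k ∈ Finset.range N, c k * v k z) atTop (𝓝 0) := by
    have := h2.sqrt
    simp_rw [Real.sqrt_sq_eq_abs, Real.sqrt_zero] at this
    exact (tendsto_zero_iff_abs_tendsto_zero _).2 this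
  have h4 := h3.const_sub (f z)
  simpa using h4

/-- If a random function is almost surely orthogonal to each element of the orthogonal complement
of a system, then almost surely it is orthogonal to all of them. -/
lemma ae_forall_orthogonal [IsSeparable μ] {Ω : Type*} [MeasurableSpace Ω] {P : Measure Ω}
    {v : ℕ → Z → ℝ} (hv : ∀ k, MemLp (v k) 2 μ) {ψ : Ω → Z → ℝ} (hψ : ∀ᵐ ω ∂P, MemLp (ψ ω) 2 μ)
    (h0 : ∀ h : Z → ℝ, MemLp h 2 μ → (∀ k, ∫ z, h z * v k z ∂μ = 0) →
      ∀ᵐ ω ∂P, ∫ z, ψ ω z * h z ∂μ = 0) :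
    ∀ᵐ ω ∂P, ∀ h : Z → ℝ, MemLp h 2 μ → (∀ k, ∫ z, h z * v k z ∂μ = 0) →
      ∫ z, ψ ω z * h z ∂μ = 0 := by
  have : Fact ((1 : ℝ≥0∞) ≤ 2) := ⟨by norm_num⟩
  have : Fact ((2 : ℝ≥0∞) ≠ ∞) := ⟨by norm_num⟩
  set N : Set (Lp ℝ 2 μ) := {h | ∀ k, inner ℝ h (hv k).toLp = 0} with hN
  -- Separability of `L²` leaves only countably many exceptional sets to collect; orthogonality to a
  -- fixed path is a closed condition and so extends from the dense subset.
  obtain ⟨c, hcN, hcc, hcd⟩ :=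
    (TopologicalSpace.IsSeparable.of_separableSpace N).exists_countable_dense_subset
  have h1 : ∀ᵐ ω ∂P, ∀ h ∈ c, ∫ z, ψ ω z * (h : Z → ℝ) z ∂μ = 0 := by
    rw [ae_ball_iff hcc]
    intro h hh
    refine h0 _ (Lp.memLp h) fun k => ?_
    rw [← inner_toLp (Lp.memLp h) (hv k), Lp.toLp_coeFn]
    have := hcN hh
    simp only [hN, Set.mem_ofPred_eq] at this
    exact this k
  filter_upwards [hψ, h1] with ω hω h1 h hh hhv
  rw [← inner_toLp hω hh]
  have hmem : hh.toLp ∈ closure c := hcd (by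
    simp only [hN, Set.mem_ofPred_eq]
    exact fun k => (inner_toLp hh (hv k)).trans (hhv k))
  have hcl : IsClosed {x : Lp ℝ 2 μ | inner ℝ hω.toLp x = 0} :=
    isClosed_eq (continuous_const.inner continuous_id) continuous_const
  have hsub : closure c ⊆ {x : Lp ℝ 2 μ | inner ℝ hω.toLp x = 0} := by
    refine closure_minimal (fun x hx => ?_) hcl
    simp only [Set.mem_ofPred_eq]
    rw [← Lp.toLp_coeFn x (Lp.memLp x), inner_toLp]
    exact h1 x hx
  exact hsub hmem

end SquareIntegrable

/-! ### Pairing a random function with functions on `Z` and with random variables. -/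

section Pairing

variable {Ω Z : Type*} [MeasurableSpace Ω] [MeasurableSpace Z] {P : Measure Ω}
  [IsProbabilityMeasure P] {μ : Measure Z} [IsProbabilityMeasure μ]

lemma memLp_two_iff_lintegral {α : Type*} [MeasurableSpace α] {ν : Measure α} {f : α → ℝ}
    (hf : AEStronglyMeasurable f ν) : MemLp f 2 ν ↔ ∫⁻ a, ‖f a‖ₑ ^ 2 ∂ν < ∞ := by
  rw [memLp_two_iff_integrable_sq hf]
  have : AEStronglyMeasurable (fun a => f a ^ 2) ν := hf.pow 2
  constructor
  · intro h; simpa [HasFiniteIntegral, enorm_pow] using h.2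
  · intro h; exact ⟨this, by simpa [HasFiniteIntegral, enorm_pow] using h⟩

variable {ψ : Z → Ω → ℝ} (hψ : Measurable fun q : Z × Ω => ψ q.1 q.2) {C : ℝ}
  (hC : ∀ z, ∫⁻ ω, ‖ψ z ω‖ₑ ^ 2 ∂P ≤ ENNReal.ofReal C)

include hψ hC

lemma memLp_section (z : Z) : MemLp (ψ z) 2 P :=
  (memLp_two_iff_lintegral (hψ.comp measurable_prodMk_left).aestronglyMeasurable).2
    ((hC z).trans_lt ENNReal.ofReal_lt_top)

lemma memLp_joint : MemLp (fun q : Z × Ω => ψ q.1 q.2) 2 (μ.prod P) := by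
  rw [memLp_two_iff_lintegral hψ.aestronglyMeasurable,
    lintegral_prod _ (hψ.enorm.pow_const 2).aemeasurable]
  calc _ ≤ ∫⁻ _ : Z, ENNReal.ofReal C ∂μ := lintegral_mono fun z => hC z
    _ < ∞ := by simp

lemma ae_memLp_path : ∀ᵐ ω ∂P, MemLp (fun z => ψ z ω) 2 μ := by
  have h := memLp_joint (μ := μ) hψ hC
  rw [memLp_two_iff_lintegral hψ.aestronglyMeasurable,
    lintegral_prod_symm _ (hψ.enorm.pow_const 2).aemeasurable] at h
  have h2 := ae_lt_top' (hψ.enorm.pow_const 2).lintegral_prod_left'.aemeasurable h.ne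
  filter_upwards [h2] with ω hω
  exact (memLp_two_iff_lintegral (hψ.comp measurable_prodMk_right).aestronglyMeasurable).2 hω

/-- Cauchy–Schwarz in `z` for each path, then integration over the paths. -/
lemma memLp_coeff {h : Z → ℝ} (hh : MemLp h 2 μ) : MemLp (fun ω => ∫ z, ψ z ω * h z ∂μ) 2 P := by
  have hm : AEStronglyMeasurable (fun q : Z × Ω => ψ q.1 q.2 * h q.1) (μ.prod P) :=
    hψ.aestronglyMeasurable.mul hh.1.comp_fst
  have hmm : AEStronglyMeasurable (fun ω => ∫ z, ψ z ω * h z ∂μ) P :=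
    hm.prod_swap.integral_prod_right'
  rw [memLp_two_iff_lintegral hmm]
  have hJ := memLp_joint (μ := μ) hψ hC
  rw [memLp_two_iff_lintegral hψ.aestronglyMeasurable,
    lintegral_prod_symm _ (hψ.enorm.pow_const 2).aemeasurable] at hJ
  have hh2 := (memLp_two_iff_lintegral hh.1).1 hh
  have hle : ∀ᵐ ω ∂P, ‖∫ z, ψ z ω * h z ∂μ‖ₑ ^ 2 ≤
      (∫⁻ z, ‖ψ z ω‖ₑ ^ 2 ∂μ) * ∫⁻ z, ‖h z‖ₑ ^ 2 ∂μ := by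
    refine ae_of_all _ fun ω => ?_
    have h1 : ‖∫ z, ψ z ω * h z ∂μ‖ₑ ≤ ∫⁻ z, ‖ψ z ω‖ₑ * ‖h z‖ₑ ∂μ :=
      (enorm_integral_le_lintegral_enorm _).trans_eq (by simp_rw [enorm_mul])
    have h2 := ENNReal.lintegral_mul_le_Lp_mul_Lq μ (p := 2) (q := 2)
      ⟨by norm_num, by norm_num, by norm_num⟩
      (hψ.comp (measurable_prodMk_right (y := ω))).enorm.aemeasurable hh.1.enorm
    have h3 := pow_le_pow_left' (h1.trans h2) 2
    refine h3.trans_eq ?_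
    rw [mul_pow]
    simp only [← ENNReal.rpow_natCast, ← ENNReal.rpow_mul]
    norm_num
  refine (lintegral_mono_ae hle).trans_lt ?_
  rw [lintegral_mul_const' _ _ hh2.ne]
  exact ENNReal.mul_lt_top hJ hh2

lemma integrable_pairing {g : Ω → ℝ} (hg : MemLp g 2 P) {h : Z → ℝ} (hh : MemLp h 2 μ) :
    Integrable (fun q : Z × Ω => ψ q.1 q.2 * g q.2 * h q.1) (μ.prod P) := by
  have hgh : MemLp (fun q : Z × Ω => g q.2 * h q.1) 2 (μ.prod P) := by
    have hm : AEStronglyMeasurable (fun q : Z × Ω => g q.2 * h q.1) (μ.prod P) :=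
      hg.1.comp_snd.mul hh.1.comp_fst
    rw [memLp_two_iff_lintegral hm]
    simp_rw [enorm_mul, mul_pow, mul_comm (‖g _‖ₑ ^ 2)]
    rw [lintegral_prod_mul (hh.1.enorm.pow_const 2) (hg.1.enorm.pow_const 2)]
    exact ENNReal.mul_lt_top ((memLp_two_iff_lintegral hh.1).1 hh)
      ((memLp_two_iff_lintegral hg.1).1 hg)
  refine ((memLp_joint (μ := μ) hψ hC).integrable_mul hgh).congr (ae_of_all _ fun q => ?_)
  simp [mul_assoc]

lemma integrable_integral_mul {g : Ω → ℝ} (hg : MemLp g 2 P) {h : Z → ℝ} (hh : MemLp h 2 μ) :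
    Integrable (fun z => (∫ ω, ψ z ω * g ω ∂P) * h z) μ := by
  refine (integrable_pairing hψ hC hg hh).integral_prod_left.congr (ae_of_all _ fun z => ?_)
  simp only
  rw [integral_mul_const]

/-- Fubini, read as an adjointness: `h ↦ ∫ ψ h dμ` from `L²(μ)` to `L²(P)` has the adjoint `g ↦ E[ψ
g]`. -/
lemma integral_pairing {g : Ω → ℝ} (hg : MemLp g 2 P) {h : Z → ℝ} (hh : MemLp h 2 μ) :
    ∫ z, (∫ ω, ψ z ω * g ω ∂P) * h z ∂μ = ∫ ω, g ω * ∫ z, ψ z ω * h z ∂μ ∂P := by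
  have h1 := integral_integral_swap (f := fun z ω => ψ z ω * g ω * h z)
    (integrable_pairing hψ hC hg hh)
  simp_rw [integral_mul_const] at h1
  rw [h1]
  congr 1 with ω
  rw [← integral_const_mul]
  congr 1 with z
  ring

end Pairing

end LMM

/-! ### Eigenfunction expansions of the random functions and of the kernel. -/

noncomputable section

namespace LMM

namespace Model

/-- The eigenfunctions, with `0` in place of those with eigenvalue `0`. -/
def eigfun {Z : Type*} (lam : ℕ → ℝ) (u : ℕ → Z → ℝ) (k : ℕ) (z : Z) : ℝ :=
  open Classical in if lam k = 0 then 0 else u k z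

variable {Ω Z : Type*} [MeasurableSpace Ω] [MeasurableSpace Z] {n p : ℕ}

/-- The coefficient of the `j`-th random function along the `k`-th eigenfunction. -/
def coeff (M : Model Ω Z n p) (lam : ℕ → ℝ) (u : ℕ → Z → ℝ) (j : Fin p) (k : ℕ) (ω : Ω) : ℝ :=
  ∫ z, M.ψ j z ω * eigfun lam u k z ∂M.μ

/-- Joint measurability and uniformly bounded second moments of the random functions. -/
structure IsBounded (M : Model Ω Z n p) (P : Measure Ω) (C : ℝ) : Prop where
  nonneg : 0 ≤ C
  meas : ∀ j, Measurable fun q : Z × Ω => M.ψ j q.1 q.2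
  bound : ∀ j z, ∫⁻ ω, ‖M.ψ j z ω‖ₑ ^ 2 ∂P ≤ ENNReal.ofReal C

variable {P : Measure Ω} [IsProbabilityMeasure P] {M : Model Ω Z n p} [IsProbabilityMeasure M.μ]
  {C : ℝ} {lam : ℕ → ℝ} {u : ℕ → Z → ℝ}

lemma feat_eq (k : ℕ) (z : Z) : feat lam u k z = √(lam k) * eigfun lam u k z := by
  rw [feat, eigfun]; split_ifs with h <;> simp [h]

lemma eigfun_memLp (heig : M.IsEigensystem P lam u) (k : ℕ) : MemLp (eigfun lam u k) 2 M.μ := by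
  by_cases h : lam k = 0
  · have : eigfun lam u k = 0 := by ext z; simp [eigfun, h]
    rw [this]; exact MemLp.zero
  · have : eigfun lam u k = u k := by ext z; simp [eigfun, h]
    rw [this]; exact heig.memLp k ((heig.nonneg k).lt_of_ne' h)

lemma integral_eigfun_mul (heig : M.IsEigensystem P lam u) {k l : ℕ} (hkl : k ≠ l) :
    ∫ z, eigfun lam u k z * eigfun lam u l z ∂M.μ = 0 := by
  by_cases h : lam k = 0
  · simp [eigfun, h]
  by_cases h' : lam l = 0
  · simp [eigfun, h']
  simpa [eigfun, h, h', hkl] using heig.orthonormal k l ((heig.nonneg k).lt_of_ne' h)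
    ((heig.nonneg l).lt_of_ne' h')

lemma eigfun_eq_zero_or (heig : M.IsEigensystem P lam u) (k : ℕ) :
    eigfun lam u k = 0 ∨ ∫ z, eigfun lam u k z * eigfun lam u k z ∂M.μ = 1 := by
  by_cases h : lam k = 0
  · left; ext z; simp [eigfun, h]
  · right
    simpa [eigfun, h] using heig.orthonormal k k ((heig.nonneg k).lt_of_ne' h)
      ((heig.nonneg k).lt_of_ne' h)

lemma lam_mul_integral_eigfun (heig : M.IsEigensystem P lam u) (k l : ℕ) :
    lam l * ∫ z, eigfun lam u k z * eigfun lam u l z ∂M.μ = if k = l then lam l else 0 := by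
  split_ifs with h
  · subst h
    by_cases h : lam k = 0
    · simp [h]
    · rcases eigfun_eq_zero_or heig k with h1 | h1
      · have := heig.orthonormal k k ((heig.nonneg k).lt_of_ne' h) ((heig.nonneg k).lt_of_ne' h)
        have h2 : u k = 0 := by
          rw [← h1]; ext z; simp [eigfun, h]
        simp [h2] at this
      · rw [h1, mul_one]
  · rw [integral_eigfun_mul heig h, mul_zero]

/-- This is the factorisation of the kernel operator as `p⁻¹ ∑ T_j* T_j` with `T_j h = ∫ ψ_j h dμ`,
on which all spectral facts below rest. -/
lemma integral_kernel_mul (hb : M.IsBounded P C) {h : Z → ℝ} (hh : MemLp h 2 M.μ) (z : Z) :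
    ∫ z', M.kernel P z z' * h z' ∂M.μ =
      (p : ℝ)⁻¹ * ∑ j, ∫ ω, M.ψ j z ω * ∫ z', M.ψ j z' ω * h z' ∂M.μ ∂P := by
  simp only [kernel, mul_assoc, Finset.sum_mul]
  rw [integral_const_mul, integral_finsetSum]
  · congr 1
    refine Finset.sum_congr rfl fun j _ => ?_
    rw [← integral_pairing (hb.meas j) (hb.bound j)
      (memLp_section (hb.meas j) (hb.bound j) z) hh]
    simp_rw [mul_comm (M.ψ j z _)]
  · intro j _
    simpa only [mul_comm (M.ψ j z _)] using integrable_integral_mul (hb.meas j) (hb.bound j)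
      (memLp_section (hb.meas j) (hb.bound j) z) hh

lemma coeff_memLp (hb : M.IsBounded P C) (heig : M.IsEigensystem P lam u) (j : Fin p) (k : ℕ) :
    MemLp (M.coeff lam u j k) 2 P :=
  memLp_coeff (hb.meas j) (hb.bound j) (eigfun_memLp heig k)

lemma integral_kernel_eigfun (heig : M.IsEigensystem P lam u) (k : ℕ) (z : Z) :
    ∫ z', M.kernel P z z' * eigfun lam u k z' ∂M.μ = lam k * eigfun lam u k z := by
  by_cases h : lam k = 0
  · simp [eigfun, h]
  · simpa [eigfun, h] using heig.eigen k ((heig.nonneg k).lt_of_ne' h) z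

lemma lam_mul_eigfun (hb : M.IsBounded P C) (heig : M.IsEigensystem P lam u) (k : ℕ) (z : Z) :
    lam k * eigfun lam u k z = (p : ℝ)⁻¹ * ∑ j, ∫ ω, M.ψ j z ω * M.coeff lam u j k ω ∂P := by
  rw [← integral_kernel_eigfun heig, integral_kernel_mul hb (eigfun_memLp heig k)]
  rfl

lemma integral_mul_kernel_mul (hb : M.IsBounded P C) {h h' : Z → ℝ} (hh : MemLp h 2 M.μ)
    (hh' : MemLp h' 2 M.μ) :
    ∫ z, h' z * ∫ z', M.kernel P z z' * h z' ∂M.μ ∂M.μ = (p : ℝ)⁻¹ * ∑ j, ∫ ω,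
      (∫ z', M.ψ j z' ω * h z' ∂M.μ) * (∫ z', M.ψ j z' ω * h' z' ∂M.μ) ∂P := by
  simp_rw [integral_kernel_mul hb hh, mul_left_comm (h' _), Finset.mul_sum, mul_comm (h' _)]
  rw [integral_finsetSum]
  · refine Finset.sum_congr rfl fun j _ => ?_
    rw [integral_const_mul, integral_pairing (hb.meas j) (hb.bound j)
      (memLp_coeff (hb.meas j) (hb.bound j) hh) hh']
  · intro j _
    exact (integrable_integral_mul (hb.meas j) (hb.bound j)
      (memLp_coeff (hb.meas j) (hb.bound j) hh) hh').const_mul _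

/-- The factorised operator is evaluated between two eigenfunctions: summed over `j`, the random
coefficients are uncorrelated with second moments `p λ_k`. -/
lemma sum_integral_coeff_mul (hb : M.IsBounded P C) (heig : M.IsEigensystem P lam u) (k l : ℕ) :
    (p : ℝ)⁻¹ * ∑ j, ∫ ω, M.coeff lam u j k ω * M.coeff lam u j l ω ∂P =
      if k = l then lam k else 0 := by
  have h1 := integral_mul_kernel_mul hb (eigfun_memLp heig k) (eigfun_memLp heig l)
  simp_rw [integral_kernel_eigfun heig, mul_left_comm _ (lam _)] at h1
  rw [integral_const_mul, lam_mul_integral_eigfun heig] at h1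
  simp only [coeff]
  rw [← h1]
  simp [eq_comm]

/-- Bessel's inequality for the feature map. -/
lemma sum_lam_mul_eigfun_sq_le (hp : 0 < p) (hb : M.IsBounded P C)
    (heig : M.IsEigensystem P lam u) (z : Z) (N : ℕ) :
    ∑ k ∈ Finset.range N, lam k * eigfun lam u k z ^ 2 ≤ M.kernel P z z := by
  set v : ℕ → ℝ := fun k => eigfun lam u k z
  have hψ := fun j => memLp_section (hb.meas j) (hb.bound j) z
  have hc := fun j k => coeff_memLp (M := M) hb heig j k
  -- The mean square error of the partial expansion at `z` is nonnegative. Expanded, it equals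
  -- `kernel z z - 2 ∑ λ_k v_k² + ∑ λ_k v_k²`.
  have h0 : 0 ≤ (p : ℝ)⁻¹ * ∑ j, ∫ ω,
      (M.ψ j z ω - ∑ k ∈ Finset.range N, v k * M.coeff lam u j k ω) ^ 2 ∂P :=
    mul_nonneg (by positivity) (Finset.sum_nonneg fun j _ =>
      integral_nonneg fun ω => sq_nonneg _)
  have e1 : ∀ j, ∫ ω, (M.ψ j z ω - ∑ k ∈ Finset.range N, v k * M.coeff lam u j k ω) ^ 2 ∂P =
      ∫ ω, M.ψ j z ω * M.ψ j z ω ∂P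
        - 2 * ∑ k ∈ Finset.range N, v k * ∫ ω, M.ψ j z ω * M.coeff lam u j k ω ∂P
        + ∑ k ∈ Finset.range N, ∑ l ∈ Finset.range N, v k * v l *
          ∫ ω, M.coeff lam u j k ω * M.coeff lam u j l ω ∂P := by
    intro j
    have i1 : Integrable (fun ω => M.ψ j z ω * M.ψ j z ω) P := (hψ j).integrable_mul (hψ j)
    have i2 : ∀ k, Integrable (fun ω => v k * (M.ψ j z ω * M.coeff lam u j k ω)) P := fun k =>
      ((hψ j).integrable_mul (hc j k)).const_mul _
    have i3 : ∀ k l, Integrable (fun ω => v k * v l *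
        (M.coeff lam u j k ω * M.coeff lam u j l ω)) P := fun k l =>
      ((hc j k).integrable_mul (hc j l)).const_mul _
    have i2' : Integrable (fun ω => ∑ k ∈ Finset.range N,
        v k * (M.ψ j z ω * M.coeff lam u j k ω)) P := integrable_finsetSum _ fun k _ => i2 k
    have i3' : Integrable (fun ω => ∑ k ∈ Finset.range N, ∑ l ∈ Finset.range N, v k * v l *
        (M.coeff lam u j k ω * M.coeff lam u j l ω)) P :=
      integrable_finsetSum _ fun k _ => integrable_finsetSum _ fun l _ => i3 k l
    have e : ∀ ω, (M.ψ j z ω - ∑ k ∈ Finset.range N, v k * M.coeff lam u j k ω) ^ 2 =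
        M.ψ j z ω * M.ψ j z ω
          - 2 * ∑ k ∈ Finset.range N, v k * (M.ψ j z ω * M.coeff lam u j k ω)
          + ∑ k ∈ Finset.range N, ∑ l ∈ Finset.range N, v k * v l *
            (M.coeff lam u j k ω * M.coeff lam u j l ω) := by
      intro ω
      rw [sub_sq, sq (∑ k ∈ _, _), Finset.sum_mul_sum, sq]
      congr 1
      · rw [mul_assoc, Finset.mul_sum]
        congr 2
        exact Finset.sum_congr rfl fun k _ => by ring
      · exact Finset.sum_congr rfl fun k _ => Finset.sum_congr rfl fun l _ => by ring
    simp_rw [e]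
    have i12 : Integrable (fun ω => M.ψ j z ω * M.ψ j z ω - 2 * ∑ k ∈ Finset.range N,
        v k * (M.ψ j z ω * M.coeff lam u j k ω)) P := i1.sub (i2'.const_mul 2)
    rw [integral_add i12 i3', integral_sub i1 (i2'.const_mul 2),
      integral_const_mul, integral_finsetSum _ fun k _ => i2 k,
      integral_finsetSum _ fun k _ => integrable_finsetSum _ fun l _ => i3 k l]
    simp_rw [integral_finsetSum _ fun l _ => i3 _ l, integral_const_mul]
  simp_rw [e1] at h0
  rw [Finset.sum_add_distrib, Finset.sum_sub_distrib, ← Finset.mul_sum, Finset.sum_comm,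
    mul_add, mul_sub] at h0
  have e2 : (p : ℝ)⁻¹ * (2 * ∑ k ∈ Finset.range N, ∑ j,
      v k * ∫ ω, M.ψ j z ω * M.coeff lam u j k ω ∂P) =
      2 * ∑ k ∈ Finset.range N, lam k * v k ^ 2 := by
    rw [mul_left_comm, Finset.mul_sum]
    congr 1
    refine Finset.sum_congr rfl fun k _ => ?_
    rw [← Finset.mul_sum, mul_left_comm, ← lam_mul_eigfun hb heig k z]
    simp only [v]; ring
  have e3 : (p : ℝ)⁻¹ * ∑ j, ∑ k ∈ Finset.range N, ∑ l ∈ Finset.range N, v k * v l *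
      ∫ ω, M.coeff lam u j k ω * M.coeff lam u j l ω ∂P =
      ∑ k ∈ Finset.range N, lam k * v k ^ 2 := by
    rw [Finset.sum_comm, Finset.mul_sum]
    refine Finset.sum_congr rfl fun k hk => ?_
    rw [Finset.sum_comm, Finset.mul_sum]
    have : ∀ l, (p : ℝ)⁻¹ * ∑ j, v k * v l *
        ∫ ω, M.coeff lam u j k ω * M.coeff lam u j l ω ∂P =
        v k * v l * if k = l then lam k else 0 := by
      intro l
      rw [← Finset.mul_sum, mul_left_comm, sum_integral_coeff_mul hb heig]
    simp_rw [this]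
    simp [hk]
    ring
  rw [e2, e3] at h0
  rw [kernel]
  simp only [v] at h0
  linarith

lemma abs_kernel_le (hp : 0 < p) (hb : M.IsBounded P C) (z z' : Z) : |M.kernel P z z'| ≤ C := by
  have hsq : ∀ j z, ∫ ω, M.ψ j z ω ^ 2 ∂P ≤ C := by
    intro j z
    rw [integral_eq_lintegral_of_nonneg_ae (ae_of_all _ fun _ => sq_nonneg _)
      (memLp_section (hb.meas j) (hb.bound j) z).integrable_sq.1]
    refine ENNReal.toReal_le_of_le_ofReal hb.nonneg ((lintegral_mono fun ω => ?_).trans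
      (hb.bound j z))
    rw [← enorm_pow, Real.enorm_of_nonneg (sq_nonneg _)]
  have h1 : ∀ j, |∫ ω, M.ψ j z ω * M.ψ j z' ω ∂P| ≤ C := by
    intro j
    have m1 := memLp_section (hb.meas j) (hb.bound j) z
    have m2 := memLp_section (hb.meas j) (hb.bound j) z'
    calc |∫ ω, M.ψ j z ω * M.ψ j z' ω ∂P| ≤ ∫ ω, |M.ψ j z ω * M.ψ j z' ω| ∂P :=
          abs_integral_le_integral_abs
      _ ≤ ∫ ω, (2⁻¹ * M.ψ j z ω ^ 2 + 2⁻¹ * M.ψ j z' ω ^ 2) ∂P := by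
          refine integral_mono (m1.integrable_mul m2).abs
            ((m1.integrable_sq.const_mul _).add (m2.integrable_sq.const_mul _)) fun ω => ?_
          simp only
          rw [abs_mul, ← sq_abs (M.ψ j z ω), ← sq_abs (M.ψ j z' ω)]
          nlinarith [sq_nonneg (|M.ψ j z ω| - |M.ψ j z' ω|)]
      _ = 2⁻¹ * ∫ ω, M.ψ j z ω ^ 2 ∂P + 2⁻¹ * ∫ ω, M.ψ j z' ω ^ 2 ∂P := by
          rw [integral_add (m1.integrable_sq.const_mul _) (m2.integrable_sq.const_mul _),
            integral_const_mul, integral_const_mul]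
      _ ≤ C := by linarith [hsq j z, hsq j z']
  rw [kernel, abs_mul, abs_of_nonneg (by positivity), inv_mul_eq_div, div_le_iff₀ (by positivity)]
  calc _ ≤ ∑ j : Fin p, C := (Finset.abs_sum_le_sum_abs _ _).trans
        (Finset.sum_le_sum fun j _ => h1 j)
    _ = C * p := by simp [mul_comm]

lemma measurable_kernel (hb : M.IsBounded P C) :
    Measurable fun q : Z × Z => M.kernel P q.1 q.2 := by
  simp only [kernel]
  refine (Finset.measurable_sum _ fun j _ => ?_).const_mul _
  have h : StronglyMeasurable fun q : (Z × Z) × Ω => M.ψ j q.1.1 q.2 * M.ψ j q.1.2 q.2 :=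
    (((hb.meas j).comp (measurable_fst.fst.prodMk measurable_snd)).mul
      ((hb.meas j).comp (measurable_fst.snd.prodMk measurable_snd))).stronglyMeasurable
  exact h.integral_prod_right.measurable

lemma kernel_memLp (hp : 0 < p) (hb : M.IsBounded P C) (z : Z) :
    MemLp (fun z' => M.kernel P z z') 2 M.μ :=
  MemLp.of_bound ((measurable_kernel hb).comp measurable_prodMk_left).aestronglyMeasurable C
    (ae_of_all _ fun z' => abs_kernel_le hp hb z z')

/-- A function orthogonal to all eigenfunctions is almost surely orthogonal to the random
functions. -/
lemma ae_integral_mul_eq_zero (hp : 0 < p) (hb : M.IsBounded P C)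
    (heig : M.IsEigensystem P lam u) {h : Z → ℝ} (hh : MemLp h 2 M.μ)
    (h0 : ∀ k, ∫ z, h z * eigfun lam u k z ∂M.μ = 0) (j : Fin p) :
    ∀ᵐ ω ∂P, ∫ z, M.ψ j z ω * h z ∂M.μ = 0 := by
  have h1 : ∀ᵐ z ∂M.μ, ∫ z', M.kernel P z z' * h z' ∂M.μ = 0 := by
    refine heig.complete h hh fun k hk => ?_
    simpa [eigfun, hk.ne'] using h0 k
  have h2 : ∫ z, h z * ∫ z', M.kernel P z z' * h z' ∂M.μ ∂M.μ = 0 := by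
    rw [integral_eq_zero_of_ae]
    filter_upwards [h1] with z hz
    simp [hz]
  -- The vanishing quadratic form is an average of the nonnegative terms `E|∫ ψ_j h dμ|²`, so each
  -- of them is zero.
  rw [integral_mul_kernel_mul hb hh hh] at h2
  have hp' : (p : ℝ)⁻¹ ≠ 0 := by positivity
  have h3 := (mul_eq_zero.1 h2).resolve_left hp'
  rw [Finset.sum_eq_zero_iff_of_nonneg fun j _ => integral_nonneg fun ω => mul_self_nonneg _] at h3
  have h4 := h3 j (Finset.mem_univ _)
  have hL := memLp_coeff (hb.meas j) (hb.bound j) hh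
  rw [integral_eq_zero_iff_of_nonneg (fun ω => mul_self_nonneg _) (hL.integrable_mul hL)] at h4
  filter_upwards [h4] with ω hω
  simpa using hω

lemma lintegral_coeff_sq_le (hp : 0 < p) (hb : M.IsBounded P C) (heig : M.IsEigensystem P lam u)
    (j : Fin p) (k : ℕ) :
    ∫⁻ ω, ENNReal.ofReal (M.coeff lam u j k ω ^ 2) ∂P ≤ ENNReal.ofReal (p * lam k) := by
  have h := sum_integral_coeff_mul hb heig k k
  rw [if_pos rfl, inv_mul_eq_div, div_eq_iff (by positivity)] at h
  rw [← ofReal_integral_eq_lintegral_ofReal (coeff_memLp hb heig j k).integrable_sq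
    (ae_of_all _ fun _ => sq_nonneg _)]
  refine ENNReal.ofReal_le_ofReal ?_
  rw [mul_comm, ← h]
  simp_rw [sq]
  exact Finset.single_le_sum (f := fun j => ∫ ω, M.coeff lam u j k ω * M.coeff lam u j k ω ∂P)
    (fun j _ => integral_nonneg fun ω => mul_self_nonneg _) (Finset.mem_univ j)

/-- The expected sum is at most `p ∑ (k + 1) λ_k`, which is finite; this is how the eigenvalue decay
reaches the individual paths. -/
lemma ae_summable_coeff (hp : 0 < p) (hb : M.IsBounded P C) (heig : M.IsEigensystem P lam u)
    (hdecay : Summable (fun k : ℕ => ((k : ℝ) + 1) * lam k)) (j : Fin p) :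
    ∀ᵐ ω ∂P, Summable fun k : ℕ => ((k : ℝ) + 1) * M.coeff lam u j k ω ^ 2 := by
  have hm : ∀ k : ℕ, AEMeasurable (fun ω => ENNReal.ofReal
      (((k : ℝ) + 1) * M.coeff lam u j k ω ^ 2)) P := fun k =>
    (((coeff_memLp hb heig j k).1.aemeasurable.pow_const 2).const_mul _).ennreal_ofReal
  have h : ∫⁻ ω, ∑' k : ℕ, ENNReal.ofReal (((k : ℝ) + 1) * M.coeff lam u j k ω ^ 2) ∂P ≠ ∞ := by
    rw [lintegral_tsum hm]
    refine ne_top_of_le_ne_top (hdecay.mul_left (p : ℝ)).tsum_ofReal_ne_top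
      (ENNReal.tsum_le_tsum fun k => ?_)
    have e : ∀ ω, ENNReal.ofReal (((k : ℝ) + 1) * M.coeff lam u j k ω ^ 2) =
        ENNReal.ofReal ((k : ℝ) + 1) * ENNReal.ofReal (M.coeff lam u j k ω ^ 2) := fun ω =>
      ENNReal.ofReal_mul (by positivity)
    simp_rw [e]
    rw [lintegral_const_mul' _ _ ENNReal.ofReal_ne_top, mul_left_comm,
      ENNReal.ofReal_mul (by positivity)]
    gcongr
    exact lintegral_coeff_sq_le hp hb heig j k
  filter_upwards [ae_lt_top' (AEMeasurable.tsum hm) h] with ω hω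
  have h1 := ENNReal.summable_toReal hω.ne
  refine h1.congr fun k => ?_
  rw [ENNReal.toReal_ofReal (by positivity)]

/-- The expansion of the random functions along the eigenfunctions. -/
lemma ae_ae_tendsto_expansion [IsSeparable M.μ] (hp : 0 < p) (hb : M.IsBounded P C)
    (heig : M.IsEigensystem P lam u)
    (hdecay : Summable (fun k : ℕ => ((k : ℝ) + 1) * lam k)) (j : Fin p) :
    ∀ᵐ ω ∂P, ∀ᵐ z ∂M.μ, Tendsto (fun N => ∑ k ∈ Finset.range N,
      M.coeff lam u j k ω * eigfun lam u k z) atTop (𝓝 (M.ψ j z ω)) := by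
  have hL := ae_memLp_path (μ := M.μ) (hb.meas j) (hb.bound j)
  filter_upwards [hL, ae_summable_coeff hp hb heig hdecay j,
    ae_forall_orthogonal (eigfun_memLp heig) hL fun h hh h0 =>
      ae_integral_mul_eq_zero hp hb heig hh h0 j] with ω h1 h2 h3
  exact ae_tendsto_orthogonal_series (eigfun_memLp heig)
    (fun k l hkl => integral_eigfun_mul heig hkl) (eigfun_eq_zero_or heig) h1 h3 h2

lemma summable_lam_mul_eigfun_sq (hp : 0 < p) (hb : M.IsBounded P C)
    (heig : M.IsEigensystem P lam u) (z : Z) :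
    Summable fun k => lam k * eigfun lam u k z ^ 2 :=
  summable_of_sum_range_le (fun k => mul_nonneg (heig.nonneg k) (sq_nonneg _))
    (sum_lam_mul_eigfun_sq_le hp hb heig z)

/-- Mercer's expansion of the kernel. -/
lemma ae_tendsto_mercer (hp : 0 < p) (hb : M.IsBounded P C) (heig : M.IsEigensystem P lam u)
    (hdecay : Summable (fun k : ℕ => ((k : ℝ) + 1) * lam k)) (z : Z) :
    ∀ᵐ z' ∂M.μ, Tendsto (fun N => ∑ k ∈ Finset.range N,
      feat lam u k z * feat lam u k z') atTop (𝓝 (M.kernel P z z')) := by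
  have hspan : ∀ h : Z → ℝ, MemLp h 2 M.μ → (∀ k, ∫ z, h z * eigfun lam u k z ∂M.μ = 0) →
      ∫ z', M.kernel P z z' * h z' ∂M.μ = 0 := by
    intro h hh h0
    rw [integral_kernel_mul hb hh, Finset.sum_eq_zero, mul_zero]
    intro j _
    refine integral_eq_zero_of_ae ?_
    filter_upwards [ae_integral_mul_eq_zero hp hb heig hh h0 j] with ω hω
    simp [hω]
  -- The coefficients of `kernel(z, ·)` are `λ_k e_k(z)`. In `(k + 1) λ_k² e_k(z)²`, one factor `(k
  -- + 1) λ_k` is bounded and the remaining `λ_k e_k(z)²` is summable by Bessel.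
  have hbd : ∃ B : ℝ, ∀ k : ℕ, ((k : ℝ) + 1) * lam k ≤ B := by
    obtain ⟨B, hB⟩ := hdecay.tendsto_atTop_zero.bddAbove_range
    exact ⟨B, fun k => hB ⟨k, rfl⟩⟩
  obtain ⟨B, hB⟩ := hbd
  have hsum : Summable fun k : ℕ => ((k : ℝ) + 1) *
      (∫ z', M.kernel P z z' * eigfun lam u k z' ∂M.μ) ^ 2 := by
    simp_rw [integral_kernel_eigfun heig]
    refine ((summable_lam_mul_eigfun_sq hp hb heig z).mul_left B).of_nonneg_of_le
      (fun k => by positivity) fun k => ?_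
    have := mul_le_mul_of_nonneg_right (hB k)
      (mul_nonneg (heig.nonneg k) (sq_nonneg (eigfun lam u k z)))
    calc _ = ((k : ℝ) + 1) * lam k * (lam k * eigfun lam u k z ^ 2) := by ring
      _ ≤ _ := this
  have := ae_tendsto_orthogonal_series (eigfun_memLp heig)
    (fun k l hkl => integral_eigfun_mul heig hkl) (eigfun_eq_zero_or heig)
    (kernel_memLp hp hb z) hspan hsum
  filter_upwards [this] with z' hz'
  refine hz'.congr fun N => Finset.sum_congr rfl fun k _ => ?_
  rw [integral_kernel_eigfun heig, feat_eq, feat_eq, mul_mul_mul_comm,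
    Real.mul_self_sqrt (heig.nonneg k), mul_assoc]

/-- Membership in `L²` gives only almost everywhere measurability. The eigenvalue equation holds at
every point and expresses the eigenfunction as a kernel integral, which is measurable. -/
lemma measurable_eigfun (hb : M.IsBounded P C) (heig : M.IsEigensystem P lam u) (k : ℕ) :
    Measurable (eigfun lam u k) := by
  by_cases h : lam k = 0
  · have : eigfun lam u k = 0 := by ext z; simp [eigfun, h]
    rw [this]; exact measurable_zero
  have e : eigfun lam u k = fun z => (lam k)⁻¹ * ∫ z', M.kernel P z z' *
      (eigfun_memLp heig k).1.mk (eigfun lam u k) z' ∂M.μ := by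
    ext z
    have : ∫ z', M.kernel P z z' * (eigfun_memLp heig k).1.mk (eigfun lam u k) z' ∂M.μ =
        ∫ z', M.kernel P z z' * eigfun lam u k z' ∂M.μ := by
      refine integral_congr_ae ?_
      filter_upwards [(eigfun_memLp heig k).1.ae_eq_mk] with z' hz'
      rw [← hz']
    rw [this, integral_kernel_eigfun heig, inv_mul_cancel_left₀ h]
  rw [e]
  refine Measurable.const_mul ?_ _
  have hs : StronglyMeasurable fun q : Z × Z => M.kernel P q.1 q.2 *
      (eigfun_memLp heig k).1.mk (eigfun lam u k) q.2 :=
    (measurable_kernel hb).stronglyMeasurable.mul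
      ((eigfun_memLp heig k).1.stronglyMeasurable_mk.comp_measurable measurable_snd)
  exact hs.integral_prod_right.measurable

end Model

/-! ### Evaluation at an independent random point. -/

lemma lintegral_comp_prodMk_of_indep {Ω α : Type*} [MeasurableSpace α] (m : MeasurableSpace Ω)
    [m0 : MeasurableSpace Ω] {P : Measure Ω} [IsProbabilityMeasure P] (hm : m ≤ m0) {f : Ω → α}
    (hf : Measurable f) (hind : Indep (MeasurableSpace.comap f inferInstance) m P)
    {F : α × Ω → ℝ≥0∞} (hF : Measurable[(inferInstance : MeasurableSpace α).prod m] F) :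
    ∫⁻ ω, F (f ω, ω) ∂P = ∫⁻ a, ∫⁻ ω, F (a, ω) ∂P ∂(P.map f) := by
  have hI : @IndepFun Ω α Ω m0 _ m f id P := by
    refine (@IndepFun_iff_Indep Ω α Ω m0 _ m f id P).2 ?_
    simpa only [MeasurableSpace.comap_id] using hind
  have h1 := @lintegral_comp_of_indepFun Ω m0 P _ α Ω _ m f id hf (measurable_id'' hm) hI F hF
  simp only [id] at h1
  have hF' : Measurable F := hF.mono (sup_le_sup_left (MeasurableSpace.comap_mono hm) _) le_rfl
  rw [h1, lintegral_map hF'.lintegral_prod_right' hf]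

lemma ae_prodMk_of_indep {Ω α : Type*} [MeasurableSpace α] (m : MeasurableSpace Ω)
    [m0 : MeasurableSpace Ω] {P : Measure Ω} [IsProbabilityMeasure P] (hm : m ≤ m0) {f : Ω → α}
    (hf : Measurable f) (hind : Indep (MeasurableSpace.comap f inferInstance) m P)
    {s : Set (α × Ω)} (hs : MeasurableSet[(inferInstance : MeasurableSpace α).prod m] s)
    (h : ∀ᵐ ω ∂P, ∀ᵐ a ∂(P.map f), (a, ω) ∈ s) : ∀ᵐ ω ∂P, (f ω, ω) ∈ s := by
  set F : α × Ω → ℝ≥0∞ := sᶜ.indicator fun _ => 1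
  have hF : Measurable[(inferInstance : MeasurableSpace α).prod m] F :=
    (@measurable_const ℝ≥0∞ (α × Ω) _ (MeasurableSpace.prod _ m) 1).indicator hs.compl
  have hF' : Measurable F := hF.mono (sup_le_sup_left (MeasurableSpace.comap_mono hm) _) le_rfl
  have : IsProbabilityMeasure (P.map f) := Measure.isProbabilityMeasure_map hf.aemeasurable
  have h1 := lintegral_comp_prodMk_of_indep m hm hf hind hF
  -- The hypothesis fixes `ω` first and the point second, so the order of integration is exchanged
  -- before the indicator of the exceptional set is integrated.
  rw [lintegral_lintegral_swap (f := fun a ω => F (a, ω)) hF'.aemeasurable] at h1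
  have h2 : ∫⁻ ω, ∫⁻ a, F (a, ω) ∂(P.map f) ∂P = 0 := by
    rw [lintegral_eq_zero_iff' hF'.lintegral_prod_left'.aemeasurable]
    filter_upwards [h] with ω hω
    refine (lintegral_eq_zero_iff' (hF'.comp measurable_prodMk_right).aemeasurable).2 ?_
    filter_upwards [hω] with a ha
    simp [F, ha]
  rw [h2] at h1
  filter_upwards [(lintegral_eq_zero_iff' (hF'.comp (hf.prodMk measurable_id)).aemeasurable).1 h1]
    with ω hω
  by_contra hc
  simp [F, hc] at hω

namespace Model

variable {Ω Z : Type*} [MeasurableSpace Z] {n p : ℕ}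

/-- The σ-algebra generated by the sources in `T`. -/
@[reducible] def sigmaOf (M : Model Ω Z n p) (T : Set (Source n p)) : MeasurableSpace Ω :=
  ⨆ s ∈ T, M.sigma s

/-! ### Bookkeeping of the sources that each quantity depends on. -/

section Measurability

variable {M : Model Ω Z n p} {T : Set (Source n p)}

lemma sigma_le_sigmaOf {s : Source n p} (hs : s ∈ T) : M.sigma s ≤ M.sigmaOf T :=
  le_iSup₂ (f := fun s (_ : s ∈ T) => M.sigma s) s hs

lemma measurable_z {i : Fin n} (h : .latent i ∈ T) : Measurable[M.sigmaOf T] (M.z i) :=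
  (comap_measurable (M.z i)).mono (sigma_le_sigmaOf h) le_rfl

lemma measurable_zTest (h : .testLatent ∈ T) : Measurable[M.sigmaOf T] M.zTest :=
  (comap_measurable M.zTest).mono (sigma_le_sigmaOf h) le_rfl

lemma measurable_E {i : Fin n} {j : Fin p} (h : .noise i j ∈ T) :
    Measurable[M.sigmaOf T] (M.E i j) :=
  (comap_measurable (M.E i j)).mono (sigma_le_sigmaOf h) le_rfl

lemma measurable_eTest {j : Fin p} (h : .testNoise j ∈ T) :
    Measurable[M.sigmaOf T] (M.eTest j) :=
  (comap_measurable (M.eTest j)).mono (sigma_le_sigmaOf h) le_rfl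

lemma measurable_ε {i : Fin n} (h : .response i ∈ T) : Measurable[M.sigmaOf T] (M.ε i) :=
  (comap_measurable (M.ε i)).mono (sigma_le_sigmaOf h) le_rfl

variable [TopologicalSpace Z] [m0 : MeasurableSpace Ω] {P : Measure Ω}

lemma measurable_ψ_prod (hM : M.IsLMM P) {j : Fin p} (h : .feature j ∈ T) :
    Measurable[(inferInstance : MeasurableSpace Z).prod (M.sigmaOf T)]
      fun q : Z × Ω => M.ψ j q.1 q.2 :=
  (hM.ψ_meas j).mono (sup_le_sup_left (MeasurableSpace.comap_mono (sigma_le_sigmaOf h)) _) le_rfl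

lemma measurable_ψ_comp (hM : M.IsLMM P) {j : Fin p} (h : .feature j ∈ T) {f : Ω → Z}
    (hf : Measurable[M.sigmaOf T] f) : Measurable[M.sigmaOf T] fun ω => M.ψ j (f ω) ω := by
  have hq : @Measurable Ω (Z × Ω) (M.sigmaOf T) (MeasurableSpace.prod _ (M.sigmaOf T))
      fun ω => (f ω, ω) := hf.prodMk (@measurable_id Ω (M.sigmaOf T))
  exact (measurable_ψ_prod hM h).comp hq

lemma measurable_X (hM : M.IsLMM P) {i : Fin n} {j : Fin p} (h1 : .latent i ∈ T)
    (h2 : .feature j ∈ T) (h3 : .noise i j ∈ T) : Measurable[M.sigmaOf T] fun ω => M.X ω i j :=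
  (measurable_ψ_comp hM h2 (measurable_z h1)).add ((measurable_E h3).const_mul M.σx)

lemma sigma_le (hM : M.IsLMM P) (s : Source n p) : M.sigma s ≤ m0 := by
  cases s with
  | latent i => exact (hM.z_meas i).comap_le
  | feature j => exact hM.mψ_le j
  | noise i j => exact (hM.E_meas i j).comap_le
  | response i => exact (hM.ε_meas i).comap_le
  | testLatent => exact hM.zTest_meas.comap_le
  | testNoise j => exact (hM.eTest_meas j).comap_le

lemma sigmaOf_le (hM : M.IsLMM P) (T : Set (Source n p)) : M.sigmaOf T ≤ m0 :=
  iSup₂_le fun s _ => sigma_le hM s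

lemma indep_sigmaOf (hM : M.IsLMM P) {S T : Set (Source n p)} (h : Disjoint S T) :
    Indep (M.sigmaOf S) (M.sigmaOf T) P :=
  indep_iSup_of_disjoint (sigma_le hM) hM.indep h

lemma indep_sigma_sigmaOf (hM : M.IsLMM P) {s : Source n p} (h : s ∉ T) :
    Indep (M.sigma s) (M.sigmaOf T) P := by
  have := indep_sigmaOf hM (Set.disjoint_singleton_left.2 h)
  simpa [sigmaOf] using this

lemma ψ_measurable (hM : M.IsLMM P) (j : Fin p) : Measurable fun q : Z × Ω => M.ψ j q.1 q.2 :=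
  (hM.ψ_meas j).mono (sup_le_sup_left (MeasurableSpace.comap_mono (hM.mψ_le j)) _) le_rfl

lemma exists_fourth_moment_bound (hmom : M.FourthMoments P) :
    ∃ c : ℝ, 0 ≤ c ∧ ∀ j z, ∫⁻ ω, ‖M.ψ j z ω‖ₑ ^ 4 ∂P ≤ ENNReal.ofReal c := by
  obtain ⟨⟨c, hc⟩, -⟩ := hmom
  exact ⟨max c 0, le_max_right _ _, fun j z =>
    (hc j z).trans (ENNReal.ofReal_le_ofReal (le_max_left _ _))⟩

lemma isBounded_of_fourth [IsProbabilityMeasure P] (hM : M.IsLMM P) {c : ℝ} (hc0 : 0 ≤ c)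
    (hc : ∀ j z, ∫⁻ ω, ‖M.ψ j z ω‖ₑ ^ 4 ∂P ≤ ENNReal.ofReal c) : M.IsBounded P (1 + c) where
  nonneg := by positivity
  meas := ψ_measurable hM
  bound j z := by
    have h : ∀ x : ℝ≥0∞, x ^ 2 ≤ 1 + x ^ 4 := by
      intro x
      rcases le_total x 1 with h | h
      · exact (pow_le_one₀ zero_le h).trans le_self_add
      · exact (pow_le_pow_right₀ h (by norm_num)).trans le_add_self
    calc _ ≤ ∫⁻ ω, (1 + ‖M.ψ j z ω‖ₑ ^ 4) ∂P := lintegral_mono fun ω => h _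
      _ = 1 + ∫⁻ ω, ‖M.ψ j z ω‖ₑ ^ 4 ∂P := by
        rw [lintegral_add_left measurable_const]; simp
      _ ≤ 1 + ENNReal.ofReal c := by gcongr; exact hc j z
      _ = ENNReal.ofReal (1 + c) := by rw [ENNReal.ofReal_add zero_le_one hc0]; simp

end Measurability

/-! ### Evaluating the series in the features where the expansions converge. -/

section Series

variable {M : Model Ω Z n p} {lam : ℕ → ℝ} {u : ℕ → Z → ℝ}

lemma series_eq {f : ℕ → ℝ} {x : ℝ}
    (h : Tendsto (fun N => ∑ k ∈ Finset.range N, f k) atTop (𝓝 x)) : series f = x :=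
  h.limUnder_eq

/-- `W` has finitely many rows, so the sum over `j` commutes with both limits and the iterated
series becomes `⟨Wa, Wb⟩ - ⟨a, b⟩`. -/
lemma gramForm_eq {a b : ℕ → ℝ} {ω : Ω} {α β : Fin p → ℝ} {κ : ℝ}
    (ha : ∀ j, Tendsto (fun N => ∑ k ∈ Finset.range N, a k * M.W lam u j k ω) atTop (𝓝 (α j)))
    (hb : ∀ j, Tendsto (fun N => ∑ k ∈ Finset.range N, b k * M.W lam u j k ω) atTop (𝓝 (β j)))
    (hab : Tendsto (fun N => ∑ k ∈ Finset.range N, a k * b k) atTop (𝓝 κ)) :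
    M.gramForm lam u a b ω = ∑ j, α j * β j - κ := by
  have h1 : ∀ k, series (fun l => M.gramDev lam u k l ω * b l) =
      ∑ j, M.W lam u j k ω * β j - b k := by
    intro k
    refine series_eq ?_
    have h2 : Tendsto (fun N => ∑ j, M.W lam u j k ω *
        ∑ l ∈ Finset.range N, b l * M.W lam u j l ω) atTop (𝓝 (∑ j, M.W lam u j k ω * β j)) :=
      tendsto_finsetSum _ fun j _ => (hb j).const_mul _
    refine (h2.sub_const (b k)).congr' ?_
    -- Once `N > k`, the diagonal entry of the identity lies in the range and contributes `b k`.
    filter_upwards [eventually_gt_atTop k] with N hN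
    simp only [gramDev, sub_mul, Finset.sum_sub_distrib, Finset.sum_mul, Finset.mul_sum]
    congr 1
    · rw [Finset.sum_comm]
      exact Finset.sum_congr rfl fun l _ => Finset.sum_congr rfl fun j _ => by ring
    · simp [hN]
  rw [gramForm]
  simp_rw [h1]
  refine series_eq ?_
  have h2 : Tendsto (fun N => ∑ j, (∑ k ∈ Finset.range N, a k * M.W lam u j k ω) * β j
      - ∑ k ∈ Finset.range N, a k * b k) atTop (𝓝 (∑ j, α j * β j - κ)) :=
    (tendsto_finsetSum _ fun j _ => (ha j).mul_const _).sub hab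
  refine h2.congr fun N => ?_
  simp only [mul_sub, Finset.sum_sub_distrib, Finset.sum_mul, Finset.mul_sum]
  congr 1
  rw [Finset.sum_comm]
  exact Finset.sum_congr rfl fun l _ => Finset.sum_congr rfl fun j _ => by ring

variable [MeasurableSpace Ω]

/-- The eigenfunction expansion of the random functions converges at the point `z`. -/
def Expands (M : Model Ω Z n p) (lam : ℕ → ℝ) (u : ℕ → Z → ℝ) (z : Z) (ω : Ω) : Prop :=
  ∀ j, Tendsto (fun N => ∑ k ∈ Finset.range N,
    M.coeff lam u j k ω * eigfun lam u k z) atTop (𝓝 (M.ψ j z ω))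

lemma feat_mul_W {P : Measure Ω} (heig : M.IsEigensystem P lam u) (j : Fin p) (k : ℕ) (z : Z)
    (ω : Ω) : feat lam u k z * M.W lam u j k ω =
      (√(p : ℝ))⁻¹ * (M.coeff lam u j k ω * eigfun lam u k z) := by
  by_cases h : lam k = 0
  · simp [feat, W, eigfun, coeff, h]
  · have h1 : √(lam k) ≠ 0 := (Real.sqrt_pos.2 ((heig.nonneg k).lt_of_ne' h)).ne'
    simp only [feat, W, eigfun, coeff, h, if_false]
    rw [Real.sqrt_mul (heig.nonneg k), mul_inv]
    field_simp

lemma Expands.tendsto {P : Measure Ω} (heig : M.IsEigensystem P lam u) {z : Z} {ω : Ω}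
    (h : M.Expands lam u z ω) (j : Fin p) :
    Tendsto (fun N => ∑ k ∈ Finset.range N, feat lam u k z * M.W lam u j k ω) atTop
      (𝓝 ((√(p : ℝ))⁻¹ * M.ψ j z ω)) := by
  simp_rw [feat_mul_W heig, ← Finset.mul_sum]
  exact (h j).const_mul _

lemma Expands.Wfeat_eq {P : Measure Ω} (heig : M.IsEigensystem P lam u) {z : Z} {ω : Ω}
    (h : M.Expands lam u z ω) (j : Fin p) :
    M.Wfeat lam u z ω j = (√(p : ℝ))⁻¹ * M.ψ j z ω :=
  series_eq (h.tendsto heig j)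

lemma inv_sqrt_mul_mul (x y : ℝ) :
    (√(p : ℝ))⁻¹ * x * ((√(p : ℝ))⁻¹ * y) = (p : ℝ)⁻¹ * (x * y) := by
  rw [mul_mul_mul_comm, ← mul_inv, Real.mul_self_sqrt (Nat.cast_nonneg p)]

/-- The deviation of the empirical kernel from the kernel, between the test point and the
samples. -/
def kernelDev (M : Model Ω Z n p) (P : Measure Ω) (ω : Ω) (i : Fin n) : ℝ :=
  (p : ℝ)⁻¹ * ∑ j, M.ψ j (M.zTest ω) ω * M.ψ j (M.z i ω) ω - M.kernel P (M.zTest ω) (M.z i ω)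

/-- `θ̂` is a finite combination of the feature vectors of the samples. Hence `W θ̂` is read off
from the expansions at the samples, and `⟨φ(zTest), θ̂⟩` from Mercer's expansion. -/
lemma gramForm_thetaHat {P : Measure Ω} (heig : M.IsEigensystem P lam u) {ω : Ω}
    (hT : M.Expands lam u (M.zTest ω) ω) (hz : ∀ i, M.Expands lam u (M.z i ω) ω)
    (hK : ∀ i, Tendsto (fun N => ∑ k ∈ Finset.range N,
      feat lam u k (M.zTest ω) * feat lam u k (M.z i ω)) atTop
        (𝓝 (M.kernel P (M.zTest ω) (M.z i ω)))) :
    M.gramForm lam u (fun k => feat lam u k (M.zTest ω)) (M.thetaHat lam u ω) ω =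
      M.kernelDev P ω ⬝ᵥ M.dual ω := by
  have hb : ∀ j, Tendsto (fun N => ∑ k ∈ Finset.range N,
      M.thetaHat lam u ω k * M.W lam u j k ω) atTop
      (𝓝 (∑ i, (√(p : ℝ))⁻¹ * M.ψ j (M.z i ω) ω * M.dual ω i)) := by
    intro j
    have := tendsto_finsetSum Finset.univ fun i _ => ((hz i).tendsto heig j).mul_const (M.dual ω i)
    refine this.congr fun N => ?_
    simp only [thetaHat, Finset.sum_mul]
    rw [Finset.sum_comm]
    exact Finset.sum_congr rfl fun l _ => Finset.sum_congr rfl fun j _ => by ring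
  have hab : Tendsto (fun N => ∑ k ∈ Finset.range N,
      feat lam u k (M.zTest ω) * M.thetaHat lam u ω k) atTop
      (𝓝 (∑ i, M.kernel P (M.zTest ω) (M.z i ω) * M.dual ω i)) := by
    have := tendsto_finsetSum Finset.univ fun i _ => (hK i).mul_const (M.dual ω i)
    refine this.congr fun N => ?_
    simp only [thetaHat, Finset.sum_mul, Finset.mul_sum]
    rw [Finset.sum_comm]
    exact Finset.sum_congr rfl fun l _ => Finset.sum_congr rfl fun j _ => by ring
  rw [gramForm_eq (hT.tendsto heig) hb hab]
  simp only [dotProduct, kernelDev, sub_mul, Finset.sum_sub_distrib, Finset.mul_sum,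
    Finset.sum_mul]
  congr 1
  rw [Finset.sum_comm]
  refine Finset.sum_congr rfl fun l _ => Finset.sum_congr rfl fun j _ => ?_
  rw [← inv_sqrt_mul_mul]
  ring

lemma Wfeat_dotProduct {P : Measure Ω} (heig : M.IsEigensystem P lam u) {ω : Ω}
    (hT : M.Expands lam u (M.zTest ω) ω) :
    M.Wfeat lam u (M.zTest ω) ω ⬝ᵥ ((M.Emat ω)ᵀ *ᵥ M.dual ω) =
      (fun i => ∑ j, (√(p : ℝ))⁻¹ * M.ψ j (M.zTest ω) ω * M.E i j ω) ⬝ᵥ M.dual ω := by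
  rw [show M.Wfeat lam u (M.zTest ω) ω = fun j => (√(p : ℝ))⁻¹ * M.ψ j (M.zTest ω) ω from
    funext fun j => hT.Wfeat_eq heig j]
  rw [Matrix.dotProduct_mulVec, Matrix.vecMul_transpose]
  congr 1
  ext i
  simp only [Matrix.mulVec, dotProduct, Emat, Matrix.of_apply]
  exact Finset.sum_congr rfl fun j _ => mul_comm _ _

lemma eTest_dotProduct (M : Model Ω Z n p) (ω : Ω) :
    (fun j => M.eTest j ω) ⬝ᵥ ((M.X ω)ᵀ *ᵥ M.dual ω) =
      (fun i => ∑ j, M.X ω i j * M.eTest j ω) ⬝ᵥ M.dual ω := by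
  rw [Matrix.dotProduct_mulVec, Matrix.vecMul_transpose]
  rfl

/-- The form in `Δ` equals `p⁻¹ ∑ ψ_j ψ_j` minus the series defining `K`, so `K` cancels. Only
convergence of that series is needed, including on the diagonal, and Bessel's inequality provides
it. -/
lemma covX_eq (hp : 0 < p) [IsProbabilityMeasure M.μ] {P : Measure Ω} [IsProbabilityMeasure P]
    {C : ℝ} (hb : M.IsBounded P C) (heig : M.IsEigensystem P lam u) {ω : Ω}
    (hz : ∀ i, M.Expands lam u (M.z i ω) ω) :
    M.covX ω = M.K lam u ω + M.σx ^ 2 • (1 : Matrix (Fin n) (Fin n) ℝ) + M.Delta lam u ω := by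
  have hsum : ∀ i i', Summable fun k => feat lam u k (M.z i ω) * feat lam u k (M.z i' ω) := by
    intro i i'
    have hs := fun i => summable_lam_mul_eigfun_sq hp hb heig (M.z i ω)
    refine Summable.of_norm_bounded ((hs i).add (hs i')) fun k => ?_
    have h0 := heig.nonneg k
    rw [feat_eq, feat_eq, mul_mul_mul_comm, Real.mul_self_sqrt h0, Real.norm_eq_abs, abs_mul,
      abs_of_nonneg h0, ← mul_add]
    refine mul_le_mul_of_nonneg_left ?_ h0
    rw [abs_le]
    constructor <;> nlinarith [sq_nonneg (eigfun lam u k (M.z i ω) + eigfun lam u k (M.z i' ω)),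
      sq_nonneg (eigfun lam u k (M.z i ω) - eigfun lam u k (M.z i' ω))]
  ext i i'
  have hK := (hsum i i').hasSum.tendsto_sum_nat
  have hG := gramForm_eq ((hz i).tendsto heig) ((hz i').tendsto heig) hK
  have hKe : M.K lam u ω i i' = ∑' k, feat lam u k (M.z i ω) * feat lam u k (M.z i' ω) :=
    series_eq hK
  have hW : ∀ i j, M.PhiWT lam u ω i j = (√(p : ℝ))⁻¹ * M.ψ j (M.z i ω) ω := fun i j =>
    (hz i).Wfeat_eq heig j
  simp only [Delta, covX, X, Emat, Matrix.add_apply, Matrix.smul_apply, Matrix.sub_apply,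
    Matrix.of_apply, Matrix.mul_apply, Matrix.transpose_apply, smul_eq_mul, hG, hKe, hW,
    inv_sqrt_mul_mul, Finset.mul_sum]
  have hp' : (p : ℝ) ≠ 0 := by positivity
  have e0 : (p : ℝ)⁻¹ * M.σx ^ 2 * (p * (1 : Matrix (Fin n) (Fin n) ℝ) i i') =
      M.σx ^ 2 * (1 : Matrix (Fin n) (Fin n) ℝ) i i' := by field_simp
  have e1 : ∀ x : ℝ, (√(p : ℝ))⁻¹ * ((√(p : ℝ))⁻¹ * x) = (p : ℝ)⁻¹ * x := by
    intro x; rw [← mul_assoc, ← mul_inv, Real.mul_self_sqrt (Nat.cast_nonneg p)]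
  rw [mul_sub, e0, Finset.mul_sum, mul_add, Finset.mul_sum, Finset.mul_sum]
  have e2 : ∀ a b c d : ℝ, (p : ℝ)⁻¹ * ((a + M.σx * b) * (c + M.σx * d)) =
      (p : ℝ)⁻¹ * (a * c) + ((√(p : ℝ))⁻¹ * M.σx * ((√(p : ℝ))⁻¹ * a * d) +
        (√(p : ℝ))⁻¹ * M.σx * (b * ((√(p : ℝ))⁻¹ * c))) + (p : ℝ)⁻¹ * M.σx ^ 2 * (b * d) := by
    intro a b c d
    have h1 : (√(p : ℝ))⁻¹ * M.σx * ((√(p : ℝ))⁻¹ * a * d) = (p : ℝ)⁻¹ * (M.σx * a * d) := by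
      rw [← e1]; ring
    have h2 : (√(p : ℝ))⁻¹ * M.σx * (b * ((√(p : ℝ))⁻¹ * c)) = (p : ℝ)⁻¹ * (M.σx * b * c) := by
      rw [← e1]; ring
    rw [h1, h2]; ring
  simp_rw [e2, Finset.sum_add_distrib]
  ring

end Series

end Model

/-! ### Almost sure validity of the expansions at the samples and the test point. -/

namespace Model

variable {Ω Z : Type*} [m0 : MeasurableSpace Ω] [MetricSpace Z] [CompactSpace Z]
  [MeasurableSpace Z] [BorelSpace Z] {n p : ℕ} {P : Measure Ω} [IsProbabilityMeasure P]
  {M : Model Ω Z n p} [IsProbabilityMeasure M.μ] {C c : ℝ} {lam : ℕ → ℝ} {u : ℕ → Z → ℝ}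
  {T : Set (Source n p)}

lemma measurable_coeff (hM : M.IsLMM P) (hb : M.IsBounded P C) (heig : M.IsEigensystem P lam u)
    {j : Fin p} (h : .feature j ∈ T) (k : ℕ) : Measurable[M.sigmaOf T] (M.coeff lam u j k) := by
  have h1 : Measurable[(inferInstance : MeasurableSpace Z).prod (M.sigmaOf T)]
      fun q : Z × Ω => M.ψ j q.1 q.2 * eigfun lam u k q.1 :=
    (measurable_ψ_prod hM h).mul ((measurable_eigfun hb heig k).comp
      (@measurable_fst Z Ω inferInstance (M.sigmaOf T)))
  exact (@StronglyMeasurable.integral_prod_left Z Ω ℝ _ (M.sigmaOf T) M.μ _ _ _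
    (fun z ω => M.ψ j z ω * eigfun lam u k z) h1.stronglyMeasurable).measurable

lemma measurableSet_tendsto_real {β : Type*} {mβ : MeasurableSpace β} {f : ℕ → β → ℝ} {g : β → ℝ}
    (hf : ∀ N, Measurable (f N)) (hg : Measurable g) :
    MeasurableSet {x | Tendsto (fun N => f N x) atTop (𝓝 (g x))} :=
  measurableSet_tendsto_fun hf hg

lemma ae_expands (hM : M.IsLMM P) (hp : 0 < p) (hb : M.IsBounded P C)
    (heig : M.IsEigensystem P lam u) (hdecay : Summable (fun k : ℕ => ((k : ℝ) + 1) * lam k))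
    {f : Ω → Z} (hf : Measurable f) (hlaw : P.map f = M.μ)
    (hind : Indep (MeasurableSpace.comap f inferInstance) (M.sigmaOf (Set.range .feature)) P) :
    ∀ᵐ ω ∂P, M.Expands lam u (f ω) ω := by
  have hj : ∀ j, ∀ᵐ ω ∂P, Tendsto (fun N => ∑ k ∈ Finset.range N,
      M.coeff lam u j k ω * eigfun lam u k (f ω)) atTop (𝓝 (M.ψ j (f ω) ω)) := by
    intro j
    have hs : MeasurableSet[(inferInstance : MeasurableSpace Z).prod
        (M.sigmaOf (Set.range .feature))] {q : Z × Ω | Tendsto (fun N => ∑ k ∈ Finset.range N,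
        M.coeff lam u j k q.2 * eigfun lam u k q.1) atTop (𝓝 (M.ψ j q.1 q.2))} := by
      refine measurableSet_tendsto_real (fun N => ?_)
        (measurable_ψ_prod hM (Set.mem_range_self j))
      refine Finset.measurable_sum _ fun k _ => ?_
      exact ((measurable_coeff hM hb heig (Set.mem_range_self j) k).comp
        (@measurable_snd Z Ω inferInstance (M.sigmaOf _))).mul ((measurable_eigfun hb heig k).comp
        (@measurable_fst Z Ω inferInstance (M.sigmaOf _)))
    refine ae_prodMk_of_indep _ (sigmaOf_le hM _) hf hind hs ?_
    rw [hlaw]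
    exact ae_ae_tendsto_expansion hp hb heig hdecay j
  rw [← ae_all_iff] at hj
  exact hj

lemma ae_expands_z (hM : M.IsLMM P) (hp : 0 < p) (hb : M.IsBounded P C)
    (heig : M.IsEigensystem P lam u) (hdecay : Summable (fun k : ℕ => ((k : ℝ) + 1) * lam k)) :
    ∀ᵐ ω ∂P, ∀ i, M.Expands lam u (M.z i ω) ω :=
  ae_all_iff.2 fun i => ae_expands hM hp hb heig hdecay (hM.z_meas i) (hM.z_law i)
    (indep_sigma_sigmaOf hM (s := .latent i) (by simp))

lemma ae_expands_zTest (hM : M.IsLMM P) (hp : 0 < p) (hb : M.IsBounded P C)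
    (heig : M.IsEigensystem P lam u) (hdecay : Summable (fun k : ℕ => ((k : ℝ) + 1) * lam k)) :
    ∀ᵐ ω ∂P, M.Expands lam u (M.zTest ω) ω :=
  ae_expands hM hp hb heig hdecay hM.zTest_meas hM.zTest_law
    (indep_sigma_sigmaOf hM (s := .testLatent) (by simp))

lemma measurable_feat (hb : M.IsBounded P C) (heig : M.IsEigensystem P lam u) (k : ℕ) :
    Measurable (feat lam u k) := by
  have : feat lam u k = fun z => √(lam k) * eigfun lam u k z := funext fun z => feat_eq k z
  rw [this]
  exact (measurable_eigfun hb heig k).const_mul _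

lemma ae_mercer (hM : M.IsLMM P) (hp : 0 < p) (hb : M.IsBounded P C)
    (heig : M.IsEigensystem P lam u) (hdecay : Summable (fun k : ℕ => ((k : ℝ) + 1) * lam k)) :
    ∀ᵐ ω ∂P, ∀ i, Tendsto (fun N => ∑ k ∈ Finset.range N,
      feat lam u k (M.zTest ω) * feat lam u k (M.z i ω)) atTop
        (𝓝 (M.kernel P (M.zTest ω) (M.z i ω))) := by
  refine ae_all_iff.2 fun i => ?_
  have hφ := fun k => measurable_feat hb heig k
  obtain ⟨T, hTm, hTi⟩ : ∃ T : Set (Source n p), .testLatent ∈ T ∧ .latent i ∉ T :=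
    ⟨{.testLatent}, by simp, by simp⟩
  have hT := measurable_zTest (M := M) hTm
  have hs : MeasurableSet {q : Z × Z | Tendsto (fun N => ∑ k ∈ Finset.range N,
      feat lam u k q.1 * feat lam u k q.2) atTop (𝓝 (M.kernel P q.1 q.2))} :=
    measurableSet_tendsto_real (fun N => Finset.measurable_sum _ fun k _ =>
      ((hφ k).comp measurable_fst).mul ((hφ k).comp measurable_snd)) (measurable_kernel hb)
  have h1 : Measurable[(inferInstance : MeasurableSpace Z).prod (M.sigmaOf T)]
      fun q : Z × Ω => (M.zTest q.2, q.1) :=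
    (hT.comp (@measurable_snd Z Ω inferInstance (M.sigmaOf T))).prodMk
      (@measurable_fst Z Ω inferInstance (M.sigmaOf T))
  have h2 := ae_prodMk_of_indep (M.sigmaOf T) (sigmaOf_le hM _) (hM.z_meas i)
    (indep_sigma_sigmaOf hM (s := .latent i) hTi) (h1 hs) (by
      rw [hM.z_law i]
      -- Mercer's expansion holds for every first argument and almost every second one, so the test
      -- point may be frozen and the independent sample drawn afterwards.
      exact ae_of_all _ fun ω => ae_tendsto_mercer hp hb heig hdecay (M.zTest ω))
  exact h2

/-! ### Mean square deviation of the empirical kernel. -/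

section Variance

variable (hM : M.IsLMM P) (hc : ∀ j z, ∫⁻ ω, ‖M.ψ j z ω‖ₑ ^ 4 ∂P ≤ ENNReal.ofReal c)

include hM hc

lemma lintegral_mul_sq_le (j : Fin p) (z z' : Z) :
    ∫⁻ ω, ‖M.ψ j z ω * M.ψ j z' ω‖ₑ ^ 2 ∂P ≤ 2 * ENNReal.ofReal c := by
  have h : ∀ x y : ℝ≥0∞, (x * y) ^ 2 ≤ x ^ 4 + y ^ 4 := by
    intro x y
    rcases le_total x y with h | h
    · calc (x * y) ^ 2 ≤ (y * y) ^ 2 := by gcongr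
        _ = y ^ 4 := by ring
        _ ≤ _ := le_add_self
    · calc (x * y) ^ 2 ≤ (x * x) ^ 2 := by gcongr
        _ = x ^ 4 := by ring
        _ ≤ _ := le_self_add
  have hm := fun z => (((ψ_measurable hM j).comp (measurable_prodMk_left (x := z))).enorm.pow_const 4)
  calc _ ≤ ∫⁻ ω, (‖M.ψ j z ω‖ₑ ^ 4 + ‖M.ψ j z' ω‖ₑ ^ 4) ∂P :=
        lintegral_mono fun ω => by simpa only [enorm_mul] using h _ _
    _ = _ := lintegral_add_left (hm z) _
    _ ≤ _ := by rw [two_mul]; gcongr <;> exact hc _ _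

lemma memLp_mul (j : Fin p) (z z' : Z) : MemLp (fun ω => M.ψ j z ω * M.ψ j z' ω) 2 P := by
  have hm := fun z => (ψ_measurable hM j).comp (measurable_prodMk_left (x := z))
  exact (memLp_two_iff_lintegral ((hm z).mul (hm z')).aestronglyMeasurable).2
    ((lintegral_mul_sq_le hM hc j z z').trans_lt
      (ENNReal.mul_lt_top (by simp) ENNReal.ofReal_lt_top))

lemma le_v₁ (hc0 : 0 ≤ c) (z z' : Z) :
    (p : ℝ)⁻¹ * ∑ j, variance (fun ω => M.ψ j z ω * M.ψ j z' ω) P ≤ M.v₁ P := by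
  have hvar : ∀ j z z', variance (fun ω => M.ψ j z ω * M.ψ j z' ω) P ≤ 2 * c := by
    intro j z z'
    have hL := memLp_mul hM hc j z z'
    refine (ENNReal.ofReal_le_ofReal_iff (by positivity)).1 ?_
    rw [ofReal_variance hL, evariance_def' hL.1, ENNReal.ofReal_mul zero_le_two]
    refine tsub_le_self.trans ((lintegral_mul_sq_le hM hc j z z').trans_eq (by simp))
  -- A real supremum over an unbounded family has the default value `0`; the fourth moments supply
  -- the bound that makes `v₁` a true supremum.
  refine le_ciSup (f := fun q : Z × Z => (p : ℝ)⁻¹ *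
    ∑ j, variance (fun ω => M.ψ j q.1 ω * M.ψ j q.2 ω) P) ⟨(p : ℝ)⁻¹ * ∑ _j : Fin p, 2 * c, ?_⟩
    (z, z')
  rintro _ ⟨q, rfl⟩
  exact mul_le_mul_of_nonneg_left (Finset.sum_le_sum fun j _ => hvar j _ _) (by positivity)

/-- The products `ψ_j(z) ψ_j(z')` are independent over `j`, so variances add: `p⁻² ∑ Var ≤ v₁ / p`.
-/
lemma lintegral_kernel_deviation_le (hc0 : 0 ≤ c) (z z' : Z) :
    ∫⁻ ω, ENNReal.ofReal (((p : ℝ)⁻¹ * ∑ j, M.ψ j z ω * M.ψ j z' ω - M.kernel P z z') ^ 2) ∂P ≤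
      ENNReal.ofReal (M.v₁ P / p) := by
  have hL := fun j => memLp_mul hM hc j z z'
  have hmean : ∫ ω, (p : ℝ)⁻¹ * ∑ j, M.ψ j z ω * M.ψ j z' ω ∂P = M.kernel P z z' := by
    rw [integral_const_mul, integral_finsetSum _ fun j _ => (hL j).integrable (by norm_num), kernel]
  have hS : MemLp (fun ω => (p : ℝ)⁻¹ * ∑ j, M.ψ j z ω * M.ψ j z' ω) 2 P :=
    (memLp_finsetSum _ fun j _ => hL j).const_mul _
  have hind : Set.Pairwise (Finset.univ : Finset (Fin p)) fun j j' =>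
      IndepFun (fun ω => M.ψ j z ω * M.ψ j z' ω) (fun ω => M.ψ j' z ω * M.ψ j' z' ω) P := by
    intro j _ j' _ hjj
    have hI := hM.indep.indep (i := Source.feature j) (j := Source.feature j') (by simpa using hjj)
    have hm : ∀ j z, Measurable[M.mψ j] (M.ψ j z) := fun j z =>
      (hM.ψ_meas j).comp (@measurable_prodMk_left Z Ω _ (M.mψ j) z)
    rw [IndepFun_iff_Indep]
    exact indep_of_indep_of_le_left (indep_of_indep_of_le_right hI
      ((hm j' z).mul (hm j' z')).comap_le) ((hm j z).mul (hm j z')).comap_le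
  have hv := IndepFun.variance_sum (fun j _ => hL j) hind
  have e := evariance_eq_lintegral_ofReal (fun ω => (p : ℝ)⁻¹ * ∑ j, M.ψ j z ω * M.ψ j z' ω) P
  rw [hmean] at e
  rw [← e, ← ofReal_variance hS, variance_const_mul]
  refine ENNReal.ofReal_le_ofReal ?_
  have e2 : (fun ω => ∑ j, M.ψ j z ω * M.ψ j z' ω) =
      ∑ j, fun ω => M.ψ j z ω * M.ψ j z' ω := by ext ω; simp
  rw [e2, hv, div_eq_inv_mul, sq, mul_assoc]
  exact mul_le_mul_of_nonneg_left (le_v₁ hM hc hc0 z z') (by positivity)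

/-- The test point and then the sample are integrated out, each being independent of what remains;
the bound at fixed points is uniform. -/
lemma lintegral_kernelDev_sq_le (hb : M.IsBounded P C) (hc0 : 0 ≤ c) (i : Fin n) :
    ∫⁻ ω, ENNReal.ofReal (M.kernelDev P ω i ^ 2) ∂P ≤ ENNReal.ofReal (M.v₁ P / p) := by
  have hk := measurable_kernel hb
  set T : Set (Source n p) := insert (.latent i) (Set.range .feature)
  have hz : Measurable[M.sigmaOf T] (M.z i) := measurable_z (Set.mem_insert _ _)
  have hψz : ∀ j, Measurable[M.sigmaOf T] fun ω => M.ψ j (M.z i ω) ω := fun j =>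
    measurable_ψ_comp hM (Set.mem_insert_of_mem _ (Set.mem_range_self j)) hz
  have hF : Measurable[(inferInstance : MeasurableSpace Z).prod (M.sigmaOf T)] fun q : Z × Ω =>
      ENNReal.ofReal (((p : ℝ)⁻¹ * ∑ j, M.ψ j q.1 q.2 * M.ψ j (M.z i q.2) q.2 -
        M.kernel P q.1 (M.z i q.2)) ^ 2) := by
    have h1 := @measurable_fst Z Ω inferInstance (M.sigmaOf T)
    have h2 := @measurable_snd Z Ω inferInstance (M.sigmaOf T)
    refine (Measurable.pow_const (Measurable.sub (Measurable.const_mul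
      (Finset.measurable_sum _ fun j _ => ?_) _) ?_) 2).ennreal_ofReal
    · exact (measurable_ψ_prod hM (Set.mem_insert_of_mem _ (Set.mem_range_self j))).mul ((hψz j).comp h2)
    · exact hk.comp (h1.prodMk (hz.comp h2))
  have h1 := lintegral_comp_prodMk_of_indep _ (sigmaOf_le hM T) hM.zTest_meas
    (indep_sigma_sigmaOf hM (s := .testLatent) (by simp [T])) hF
  simp only [kernelDev]
  refine h1.trans_le ?_
  rw [hM.zTest_law]
  calc _ ≤ ∫⁻ _ : Z, ENNReal.ofReal (M.v₁ P / p) ∂M.μ := lintegral_mono fun z => ?_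
    _ = _ := by simp
  have hF2 : Measurable[(inferInstance : MeasurableSpace Z).prod
      (M.sigmaOf (Set.range .feature))] fun q : Z × Ω =>
      ENNReal.ofReal (((p : ℝ)⁻¹ * ∑ j, M.ψ j z q.2 * M.ψ j q.1 q.2 - M.kernel P z q.1) ^ 2) := by
    have h1 := @measurable_fst Z Ω inferInstance (M.sigmaOf (Set.range .feature))
    have h2 := @measurable_snd Z Ω inferInstance (M.sigmaOf (Set.range .feature))
    refine (Measurable.pow_const (Measurable.sub (Measurable.const_mul
      (Finset.measurable_sum _ fun j _ => ?_) _) ?_) 2).ennreal_ofReal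
    · exact ((measurable_ψ_comp hM (Set.mem_range_self j) measurable_const).comp h2).mul
        (measurable_ψ_prod hM (Set.mem_range_self j))
    · exact hk.comp (measurable_const.prodMk h1)
  have h2 := lintegral_comp_prodMk_of_indep _ (sigmaOf_le hM _) (hM.z_meas i)
    (indep_sigma_sigmaOf hM (s := .latent i) (by simp)) hF2
  refine h2.trans_le ?_
  rw [hM.z_law]
  calc _ ≤ ∫⁻ _ : Z, ENNReal.ofReal (M.v₁ P / p) ∂M.μ :=
        lintegral_mono fun z' => lintegral_kernel_deviation_le hM hc hc0 z z'
    _ = _ := by simp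

end Variance

/-! ### Second moments of the noise terms, and boundedness of the regression function. -/

lemma ofReal_sq_eq (x : ℝ) : ENNReal.ofReal (x ^ 2) = ‖x‖ₑ ^ 2 := by
  rw [← enorm_pow, Real.enorm_of_nonneg (sq_nonneg _)]

lemma v₂_nonneg : 0 ≤ M.v₂ P :=
  Real.iSup_nonneg fun _ => mul_nonneg (by positivity)
    (Finset.sum_nonneg fun _ _ => integral_nonneg fun _ => by positivity)

lemma v₁_nonneg : 0 ≤ M.v₁ P :=
  Real.iSup_nonneg fun _ => mul_nonneg (by positivity)
    (Finset.sum_nonneg fun _ _ => variance_nonneg _ _)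

lemma sum_lintegral_sq_le (hp : 0 < p) (hb : M.IsBounded P C) (z : Z) :
    ∑ j, ∫⁻ ω, ENNReal.ofReal (M.ψ j z ω ^ 2) ∂P ≤ ENNReal.ofReal (p * M.v₂ P) := by
  have hsq : ∀ j z, ∫⁻ ω, ENNReal.ofReal (M.ψ j z ω ^ 2) ∂P =
      ENNReal.ofReal (∫ ω, |M.ψ j z ω| ^ 2 ∂P) := by
    intro j z
    simp_rw [sq_abs]
    rw [ofReal_integral_eq_lintegral_ofReal
      (memLp_section (hb.meas j) (hb.bound j) z).integrable_sq (ae_of_all _ fun _ => sq_nonneg _)]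
  simp_rw [hsq]
  rw [← ENNReal.ofReal_sum_of_nonneg fun j _ => integral_nonneg fun ω => by positivity]
  refine ENNReal.ofReal_le_ofReal ?_
  have hle : (p : ℝ)⁻¹ * ∑ j, ∫ ω, |M.ψ j z ω| ^ 2 ∂P ≤ M.v₂ P := by
    refine le_ciSup (f := fun z : Z => (p : ℝ)⁻¹ * ∑ j, ∫ ω, |M.ψ j z ω| ^ 2 ∂P)
      ⟨(p : ℝ)⁻¹ * ∑ _j : Fin p, C, ?_⟩ z
    rintro _ ⟨z, rfl⟩
    refine mul_le_mul_of_nonneg_left (Finset.sum_le_sum fun j _ => ?_) (by positivity)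
    have := hb.bound j z
    simp_rw [← ofReal_sq_eq] at this
    rw [hsq] at this
    exact (ENNReal.ofReal_le_ofReal_iff hb.nonneg).1 this
  rwa [inv_mul_le_iff₀ (by positivity)] at hle

lemma sum_lintegral_comp_sq_le (hM : M.IsLMM P) (hp : 0 < p) (hb : M.IsBounded P C) {f : Ω → Z}
    (hf : Measurable f) (hlaw : P.map f = M.μ)
    (hind : Indep (MeasurableSpace.comap f inferInstance) (M.sigmaOf (Set.range .feature)) P) :
    ∑ j, ∫⁻ ω, ENNReal.ofReal (M.ψ j (f ω) ω ^ 2) ∂P ≤ ENNReal.ofReal (p * M.v₂ P) := by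
  have h1 : ∀ j, ∫⁻ ω, ENNReal.ofReal (M.ψ j (f ω) ω ^ 2) ∂P =
      ∫⁻ z, ∫⁻ ω, ENNReal.ofReal (M.ψ j z ω ^ 2) ∂P ∂M.μ := by
    intro j
    rw [← hlaw]
    exact lintegral_comp_prodMk_of_indep (F := fun q => ENNReal.ofReal (M.ψ j q.1 q.2 ^ 2)) _
      (sigmaOf_le hM _) hf hind
      ((measurable_ψ_prod hM (Set.mem_range_self j)).pow_const 2).ennreal_ofReal
  simp_rw [h1]
  rw [← lintegral_finsetSum]
  · calc _ ≤ ∫⁻ _ : Z, ENNReal.ofReal (p * M.v₂ P) ∂M.μ :=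
        lintegral_mono fun z => sum_lintegral_sq_le hp hb z
      _ = _ := by simp
  · intro j _
    exact ((ψ_measurable hM j).pow_const 2).ennreal_ofReal.lintegral_prod_right'

lemma E_memLp (hM : M.IsLMM P) (i : Fin n) (j : Fin p) : MemLp (M.E i j) 2 P :=
  (hM.E_ident i j).memLp_iff.2 (hM.eTest_memLp j)

lemma E_mean (hM : M.IsLMM P) (i : Fin n) (j : Fin p) : ∫ ω, M.E i j ω ∂P = 0 := by
  rw [(hM.E_ident i j).integral_eq, hM.eTest_mean]

lemma E_var (hM : M.IsLMM P) (i : Fin n) (j : Fin p) : ∫ ω, M.E i j ω ^ 2 ∂P = 1 := by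
  rw [← hM.eTest_var j]
  exact ((hM.E_ident i j).comp (measurable_id.pow_const 2)).integral_eq

/-- With `ψ(zTest)` frozen, the row of noise has uncorrelated coordinates of unit variance, so the
mean square is `p⁻¹ ∑ ψ_j(zTest)²`. -/
lemma lintegral_noise_sq_le (hM : M.IsLMM P) (hp : 0 < p) (hb : M.IsBounded P C) (i : Fin n) :
    ∫⁻ ω, ENNReal.ofReal ((∑ j, (√(p : ℝ))⁻¹ * M.ψ j (M.zTest ω) ω * M.E i j ω) ^ 2) ∂P ≤
      ENNReal.ofReal (M.v₂ P) := by
  set T : Set (Source n p) := insert .testLatent (Set.range .feature)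
  set T' : Set (Source n p) := Set.range (.noise i)
  have hψ : ∀ j, Measurable[M.sigmaOf T] fun ω => M.ψ j (M.zTest ω) ω := fun j =>
    measurable_ψ_comp hM (Set.mem_insert_of_mem _ (Set.mem_range_self j)) (measurable_zTest (Set.mem_insert _ _))
  have hF : Measurable[(M.sigmaOf T).prod (M.sigmaOf T')] fun q : Ω × Ω => ENNReal.ofReal
      ((0 + ∑ j, (√(p : ℝ))⁻¹ * M.ψ j (M.zTest q.1) q.1 * M.E i j q.2) ^ 2) := by
    have h1 := @measurable_fst Ω Ω (M.sigmaOf T) (M.sigmaOf T')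
    have h2 := @measurable_snd Ω Ω (M.sigmaOf T) (M.sigmaOf T')
    refine (Measurable.pow_const (Measurable.const_add
      (Finset.measurable_sum _ fun j _ => ?_) _) 2).ennreal_ofReal
    exact (((hψ j).const_mul _).comp h1).mul ((measurable_E (Set.mem_range_self j)).comp h2)
  have hind : Indep (M.sigmaOf T) (M.sigmaOf T') P := indep_sigmaOf hM (by
    rw [Set.disjoint_left]; rintro s (rfl | ⟨j, rfl⟩) ⟨k, hk⟩ <;> simp at hk)
  have h1 := lintegral_diag_of_indep _ _ (sigmaOf_le hM T) (sigmaOf_le hM T') hind hF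
  simp only [zero_add] at h1
  rw [h1]
  have hp' : (0 : ℝ) ≤ (p : ℝ)⁻¹ := by positivity
  have h2 : ∀ ω, ∫⁻ ω', ENNReal.ofReal
      ((∑ j, (√(p : ℝ))⁻¹ * M.ψ j (M.zTest ω) ω * M.E i j ω') ^ 2) ∂P =
      ENNReal.ofReal (p : ℝ)⁻¹ * ∑ j, ENNReal.ofReal (M.ψ j (M.zTest ω) ω ^ 2) := by
    intro ω
    have := lintegral_sq_add_sum (fun j => E_memLp hM i j) (fun j j' hjj => by
      have hI := hM.indep.indep (i := Source.noise i j) (j := Source.noise i j') (by simpa using hjj)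
      exact (IndepFun_iff_Indep _ _ _).2 hI) (fun j => E_mean hM i j) (fun j => E_var hM i j) 0
        fun j => (√(p : ℝ))⁻¹ * M.ψ j (M.zTest ω) ω
    simp only [zero_add] at this
    rw [this, ← ENNReal.ofReal_sum_of_nonneg fun j _ => sq_nonneg _, ← ENNReal.ofReal_mul hp']
    congr 1
    simp_rw [mul_pow, inv_pow, Real.sq_sqrt (Nat.cast_nonneg p)]
    rw [← Finset.mul_sum]
    ring
  simp_rw [h2]
  rw [lintegral_const_mul' _ _ ENNReal.ofReal_ne_top, lintegral_finsetSum]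
  · calc _ ≤ ENNReal.ofReal (p : ℝ)⁻¹ * ENNReal.ofReal (p * M.v₂ P) := by
          gcongr
          exact sum_lintegral_comp_sq_le hM hp hb hM.zTest_meas hM.zTest_law
            (indep_sigma_sigmaOf hM (s := .testLatent) (by simp))
      _ = _ := by
          rw [← ENNReal.ofReal_mul hp', inv_mul_cancel_left₀ (by positivity)]
  · intro j _
    exact (((hψ j).mono (sigmaOf_le hM T) le_rfl).pow_const 2).ennreal_ofReal

lemma lintegral_X_sq (hM : M.IsLMM P) (i : Fin n) (j : Fin p) :
    ∫⁻ ω, ENNReal.ofReal (M.X ω i j ^ 2) ∂P =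
      ∫⁻ ω, ENNReal.ofReal (M.ψ j (M.z i ω) ω ^ 2) ∂P + ENNReal.ofReal (M.σx ^ 2) := by
  set T : Set (Source n p) := {.latent i, .feature j}
  set T' : Set (Source n p) := {.noise i j}
  have hψ : Measurable[M.sigmaOf T] fun ω => M.ψ j (M.z i ω) ω :=
    measurable_ψ_comp hM (by simp [T]) (measurable_z (by simp [T]))
  -- The sum over `Fin 1` puts the single noise term into the form required by
  -- `lintegral_sq_add_sum`.
  have hF : Measurable[(M.sigmaOf T).prod (M.sigmaOf T')] fun q : Ω × Ω => ENNReal.ofReal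
      ((M.ψ j (M.z i q.1) q.1 + ∑ _k : Fin 1, M.σx * M.E i j q.2) ^ 2) := by
    have h1 := @measurable_fst Ω Ω (M.sigmaOf T) (M.sigmaOf T')
    have h2 := @measurable_snd Ω Ω (M.sigmaOf T) (M.sigmaOf T')
    refine (Measurable.pow_const (Measurable.add (hψ.comp h1)
      (Finset.measurable_sum _ fun j _ => ?_)) 2).ennreal_ofReal
    exact ((measurable_E (Set.mem_singleton _)).comp h2).const_mul _
  have hind : Indep (M.sigmaOf T) (M.sigmaOf T') P := indep_sigmaOf hM (by simp [T, T'])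
  have h1 := lintegral_diag_of_indep _ _ (sigmaOf_le hM T) (sigmaOf_le hM T') hind hF
  have h2 : ∀ ω, ∫⁻ ω', ENNReal.ofReal
      ((M.ψ j (M.z i ω) ω + ∑ _k : Fin 1, M.σx * M.E i j ω') ^ 2) ∂P =
      ENNReal.ofReal (M.ψ j (M.z i ω) ω ^ 2) + ENNReal.ofReal (M.σx ^ 2) := by
    intro ω
    rw [lintegral_sq_add_sum (ι := Fin 1) (fun _ => E_memLp hM i j)
      (fun a b hab => absurd (Subsingleton.elim a b) hab) (fun _ => E_mean hM i j)
      (fun _ => E_var hM i j) _ fun _ => M.σx, ENNReal.ofReal_add (sq_nonneg _) (by positivity)]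
    simp
  simp only [h2] at h1
  rw [lintegral_add_right _ measurable_const] at h1
  simpa [X] using h1

lemma lintegral_test_noise_sq_le (hM : M.IsLMM P) (hp : 0 < p) (hb : M.IsBounded P C)
    (i : Fin n) :
    ∫⁻ ω, ENNReal.ofReal ((∑ j, M.X ω i j * M.eTest j ω) ^ 2) ∂P ≤
      ENNReal.ofReal (p * (M.v₂ P + M.σx ^ 2)) := by
  set T : Set (Source n p) := (Set.range .testNoise)ᶜ
  set T' : Set (Source n p) := Set.range .testNoise
  have hX : ∀ j, Measurable[M.sigmaOf T] fun ω => M.X ω i j := fun j =>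
    measurable_X hM (by simp [T]) (by simp [T]) (by simp [T])
  have hF : Measurable[(M.sigmaOf T).prod (M.sigmaOf T')] fun q : Ω × Ω => ENNReal.ofReal
      ((0 + ∑ j, M.X q.1 i j * M.eTest j q.2) ^ 2) := by
    have h1 := @measurable_fst Ω Ω (M.sigmaOf T) (M.sigmaOf T')
    have h2 := @measurable_snd Ω Ω (M.sigmaOf T) (M.sigmaOf T')
    refine (Measurable.pow_const (Measurable.const_add
      (Finset.measurable_sum _ fun j _ => ?_) _) 2).ennreal_ofReal
    exact ((hX j).comp h1).mul ((measurable_eTest (Set.mem_range_self j)).comp h2)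
  have hind : Indep (M.sigmaOf T) (M.sigmaOf T') P := indep_sigmaOf hM disjoint_compl_left
  have h1 := lintegral_diag_of_indep _ _ (sigmaOf_le hM T) (sigmaOf_le hM T') hind hF
  simp only [zero_add] at h1
  rw [h1]
  have h2 : ∀ ω, ∫⁻ ω', ENNReal.ofReal ((∑ j, M.X ω i j * M.eTest j ω') ^ 2) ∂P =
      ∑ j, ENNReal.ofReal (M.X ω i j ^ 2) := by
    intro ω
    have := lintegral_sq_add_sum (fun j => hM.eTest_memLp j) (fun j j' hjj => by
      have hI := hM.indep.indep (i := Source.testNoise j) (j := Source.testNoise j')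
        (by simpa using hjj)
      exact (IndepFun_iff_Indep _ _ _).2 hI) hM.eTest_mean hM.eTest_var 0 fun j => M.X ω i j
    simp only [zero_add] at this
    rw [this, ← ENNReal.ofReal_sum_of_nonneg fun j _ => sq_nonneg _]
    congr 1
    ring
  simp_rw [h2]
  rw [lintegral_finsetSum _ fun j _ =>
    (((hX j).mono (sigmaOf_le hM T) le_rfl).pow_const 2).ennreal_ofReal]
  simp_rw [lintegral_X_sq hM]
  rw [Finset.sum_add_distrib, mul_add,
    ENNReal.ofReal_add (mul_nonneg (Nat.cast_nonneg _) v₂_nonneg) (by positivity)]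
  refine add_le_add (sum_lintegral_comp_sq_le hM hp hb (hM.z_meas i) (hM.z_law i)
    (indep_sigma_sigmaOf hM (s := .latent i) (by simp))) ?_
  simp [ENNReal.ofReal_mul]

lemma measurable_g (hb : M.IsBounded P C) (heig : M.IsEigensystem P lam u)
    (hg : M.RegressionInRange lam u) : Measurable M.g := by
  obtain ⟨θ, -, -, h⟩ := hg
  refine measurable_of_tendsto_metrizable (f := fun N z => ∑ k ∈ Finset.range N,
    feat lam u k z * θ k) (fun N => ?_) (tendsto_pi_nhds.2 fun z => (h z).tendsto_sum_nat)
  exact Finset.measurable_sum _ fun k _ => (measurable_feat hb heig k).mul_const _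

/-- Cauchy–Schwarz with Bessel's inequality bounds `|g|²` by `C ∑ θ_k²`, so the real supremum of
`|g|²` is not a default value. -/
lemma sq_g_le (hp : 0 < p) (hb : M.IsBounded P C) (heig : M.IsEigensystem P lam u)
    (hg : M.RegressionInRange lam u) (z : Z) : M.g z ^ 2 ≤ ⨆ z, |M.g z| ^ 2 := by
  obtain ⟨θ, hθ, -, h⟩ := hg
  rw [← sq_abs]
  refine le_ciSup (f := fun z => |M.g z| ^ 2) ⟨C * ∑' k, θ k ^ 2, ?_⟩ z
  rintro _ ⟨z, rfl⟩
  simp only [sq_abs]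
  refine le_of_tendsto ((h z).tendsto_sum_nat.pow 2) (Eventually.of_forall fun N => ?_)
  refine (Finset.sum_mul_sq_le_sq_mul_sq _ _ _).trans ?_
  refine mul_le_mul ?_ (hθ.sum_le_tsum _ fun k _ => sq_nonneg _)
    (Finset.sum_nonneg fun _ _ => sq_nonneg _) hb.nonneg
  refine le_trans (le_of_eq ?_) ((sum_lam_mul_eigfun_sq_le hp hb heig z N).trans
    ((le_abs_self _).trans (abs_kernel_le hp hb z z)))
  refine Finset.sum_congr rfl fun k _ => ?_
  rw [feat_eq, mul_pow, Real.sq_sqrt (heig.nonneg k)]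

end Model

/-! ### Measurability of the inverse matrix. -/

lemma measurable_det {n : ℕ} {β : Type*} [MeasurableSpace β] {A : β → Matrix (Fin n) (Fin n) ℝ}
    (hA : ∀ i j, Measurable fun b => A b i j) : Measurable fun b => (A b).det := by
  simp only [Matrix.det_apply, Units.smul_def, zsmul_eq_mul]
  fun_prop

/-- The formula by determinant and adjugate also covers singular matrices, where both conventions
give `0`. -/
lemma measurable_inv_apply {n : ℕ} {β : Type*} [MeasurableSpace β]
    {A : β → Matrix (Fin n) (Fin n) ℝ} (hA : ∀ i j, Measurable fun b => A b i j) (i j : Fin n) :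
    Measurable fun b => (A b)⁻¹ i j := by
  simp only [Matrix.inv_def, Matrix.smul_apply, Ring.inverse_eq_inv', smul_eq_mul,
    Matrix.adjugate_apply]
  refine (measurable_det hA).inv.mul (measurable_det fun k l => ?_)
  simp only [Matrix.updateRow_apply]
  split_ifs
  · exact measurable_const
  · exact hA k l

lemma abs_dotProduct_mulVec_le {n : ℕ} (B : Matrix (Fin n) (Fin n) ℝ) (x : Fin n → ℝ) :
    |x ⬝ᵥ (B *ᵥ x)| ≤ specNorm B * ∑ i, x i ^ 2 := by
  have h := sq_dotProduct_mulVec_le B x x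
  refine abs_le_of_sq_le_sq ?_ (mul_nonneg (norm_nonneg _)
    (Finset.sum_nonneg fun _ _ => sq_nonneg _))
  refine h.trans_eq (by ring)

/-! ### The event of high probability. -/

namespace Model

variable {Ω Z : Type*} [m0 : MeasurableSpace Ω] [MetricSpace Z] [CompactSpace Z]
  [MeasurableSpace Z] [BorelSpace Z] {n p : ℕ} {P : Measure Ω} [IsProbabilityMeasure P]
  {M : Model Ω Z n p} [IsProbabilityMeasure M.μ] {C : ℝ} {lam : ℕ → ℝ} {u : ℕ → Z → ℝ}
  {T : Set (Source n p)}

/-- The conditions on `T` keep `A` measurable for the conditioning σ-algebra while all response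
noise is integrated out; `r` may still depend on the test sources. -/
lemma condLExp_sq_dual_le (hM : M.IsLMM P) (hgm : Measurable M.g) {G : ℝ}
    (hgG : ∀ z, M.g z ^ 2 ≤ G) (hT : ∀ i, .response i ∈ T)
    (h1 : ∀ i, .latent i ∉ T) (h2 : ∀ j, .feature j ∉ T) (h3 : ∀ i j, .noise i j ∉ T)
    {r : Ω → Fin n → ℝ} (hr : ∀ i, Measurable[M.sigmaOf (Set.range .response)ᶜ] fun ω => r ω i) :
    condLExp (M.sigmaExcept T) P (fun ω => ‖r ω ⬝ᵥ M.dual ω‖ₑ ^ 2) ≤ᵐ[P] fun ω =>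
      ENNReal.ofReal (specNorm (M.A ω)⁻¹ ^ 2 * (n * G + M.σy ^ 2)) *
        condLExp (M.sigmaExcept T) P (fun ω => ENNReal.ofReal (∑ i, r ω i ^ 2)) ω := by
  have hsub : Tᶜ ⊆ (Set.range Source.response)ᶜ :=
    Set.compl_subset_compl.2 (Set.range_subset_iff.2 hT)
  have hA : ∀ i i', Measurable[M.sigmaOf Tᶜ] fun ω => M.A ω i i' := by
    intro i i'
    simp only [A, covX, Matrix.add_apply, Matrix.smul_apply, Matrix.mul_apply,
      Matrix.transpose_apply, smul_eq_mul]
    refine Measurable.add_const (Measurable.const_mul (Finset.measurable_sum _ fun j _ => ?_) _) _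
    exact (measurable_X hM (h1 i) (h2 j) (h3 i j)).mul (measurable_X hM (h1 i') (h2 j) (h3 i' j))
  refine condLExp_sq_residual_le (M.sigmaOf Tᶜ) (M.sigmaOf (Set.range .response)ᶜ)
    (M.sigmaOf (Set.range .response)) (biSup_mono hsub) (sigmaOf_le hM _) (sigmaOf_le hM _)
    (indep_sigmaOf hM disjoint_compl_left) (r := r) (h := fun ω i => M.g (M.z i ω))
    (B := fun ω => (M.A ω)⁻¹) (ε := M.ε) hr
    (fun i => hgm.comp (measurable_z (by simp))) (fun i j => ?_)
    (fun i => measurable_ε (Set.mem_range_self i)) (fun ω i => hgG _) (sq_nonneg _) hM.ε_memLp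
    (fun i j hij => ?_) hM.ε_mean hM.ε_var
  · exact @measurable_inv_apply n Ω (M.sigmaOf Tᶜ) M.A hA i j
  · exact (IndepFun_iff_Indep _ _ _).2
      (hM.indep.indep (i := Source.response i) (j := Source.response j) (by simpa using hij))

lemma lintegral_condLExp_sum_sq_le {Ω : Type*} (m : MeasurableSpace Ω) [m0 : MeasurableSpace Ω]
    {P : Measure Ω} [IsProbabilityMeasure P] (hm : m ≤ m0) {r : Ω → Fin n → ℝ}
    (hr : ∀ i, Measurable fun ω => r ω i) {V : ℝ}
    (h : ∀ i, ∫⁻ ω, ENNReal.ofReal (r ω i ^ 2) ∂P ≤ ENNReal.ofReal V) :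
    ∫⁻ ω, condLExp m P (fun ω => ENNReal.ofReal (∑ i, r ω i ^ 2)) ω ∂P ≤
      ENNReal.ofReal (n * V) := by
  rw [lintegral_condLExp hm]
  simp_rw [ENNReal.ofReal_sum_of_nonneg fun i _ => sq_nonneg (r _ i)]
  rw [lintegral_finsetSum _ fun i _ => ((hr i).pow_const 2).ennreal_ofReal,
    ENNReal.ofReal_mul (Nat.cast_nonneg n)]
  calc _ ≤ ∑ _i : Fin n, ENNReal.ofReal V := Finset.sum_le_sum fun i _ => h i
    _ = _ := by simp

lemma boundNumerator_nonneg {δ₁ δ₂ δ₃ : ℝ} (hδ₁ : 0 < δ₁) (hδ₂ : 0 < δ₂) (hδ₃ : 0 < δ₃) :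
    0 ≤ M.boundNumerator P δ₁ δ₂ δ₃ := by
  have h1 : 0 ≤ M.v₁ P := v₁_nonneg
  have h2 : 0 ≤ M.v₂ P := v₂_nonneg
  have h3 : 0 ≤ ⨆ z, |M.g z| ^ 2 := Real.iSup_nonneg fun _ => by positivity
  rw [boundNumerator]
  positivity

lemma isHermitian_covX (M : Model Ω Z n p) (ω : Ω) : (M.covX ω).IsHermitian := by
  ext i j
  simp [covX, Matrix.mul_apply, mul_comm]

lemma isHermitian_K (M : Model Ω Z n p) (lam : ℕ → ℝ) (u : ℕ → Z → ℝ) (ω : Ω) :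
    (M.K lam u ω).IsHermitian := by
  ext i j
  simp [K, mul_comm]

/-- The event on which the residuals are controlled by the norm of `A⁻¹`. -/
lemma exists_event_residual_le (hn : 0 < n) (hp : 0 < p) (hM : M.IsLMM P)
    (hmom : M.FourthMoments P) (heig : M.IsEigensystem P lam u)
    (hdecay : Summable (fun k : ℕ => ((k : ℝ) + 1) * lam k)) (hg : M.RegressionInRange lam u)
    {δ₁ δ₂ δ₃ : ℝ} (hδ₁ : 0 < δ₁) (hδ₂ : 0 < δ₂) (hδ₃ : 0 < δ₃) :
    ∃ G : Set Ω, MeasurableSet G ∧ 1 - (δ₁ + δ₂ + δ₃) ≤ P.real G ∧ ∀ ω ∈ G,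
      M.covX ω = M.K lam u ω + M.σx ^ 2 • (1 : Matrix (Fin n) (Fin n) ℝ) + M.Delta lam u ω ∧
      M.S₁ P lam u ω + M.S₂ P lam u ω + M.S₃ P ω ≤
        ENNReal.ofReal (specNorm (M.A ω)⁻¹ ^ 2 * M.boundNumerator P δ₁ δ₂ δ₃) := by
  obtain ⟨c, hc0, hc⟩ := exists_fourth_moment_bound hmom
  have hb := isBounded_of_fourth hM hc0 hc
  have hgm := measurable_g hb heig hg
  have hgG := sq_g_le hp hb heig hg
  set G : ℝ := ⨆ z, |M.g z| ^ 2
  have hG0 : 0 ≤ G := Real.iSup_nonneg fun _ => by positivity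
  have h𝒢 : M.sigmaOf (Set.range .response)ᶜ ≤ m0 := sigmaOf_le hM _
  have hz : ∀ i, Measurable[M.sigmaOf (Set.range .response)ᶜ] (M.z i) := fun i => measurable_z (by simp)
  have hzT : Measurable[M.sigmaOf (Set.range .response)ᶜ] M.zTest := measurable_zTest (by simp)
  have hψz : ∀ i j, Measurable[M.sigmaOf (Set.range .response)ᶜ] fun ω => M.ψ j (M.z i ω) ω := fun i j =>
    measurable_ψ_comp hM (by simp) (hz i)
  have hψT : ∀ j, Measurable[M.sigmaOf (Set.range .response)ᶜ] fun ω => M.ψ j (M.zTest ω) ω := fun j =>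
    measurable_ψ_comp hM (by simp) hzT
  set r₂ : Ω → Fin n → ℝ := fun ω i => ∑ j, (√(p : ℝ))⁻¹ * M.ψ j (M.zTest ω) ω * M.E i j ω
  set r₃ : Ω → Fin n → ℝ := fun ω i => ∑ j, M.X ω i j * M.eTest j ω
  have hr₁ : ∀ i, Measurable[M.sigmaOf (Set.range .response)ᶜ] fun ω => M.kernelDev P ω i := fun i =>
    ((Finset.measurable_sum _ fun j _ => (hψT j).mul (hψz i j)).const_mul _).sub
      ((measurable_kernel hb).comp (hzT.prodMk (hz i)))
  have hr₂ : ∀ i, Measurable[M.sigmaOf (Set.range .response)ᶜ] fun ω => r₂ ω i := fun i =>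
    Finset.measurable_sum _ fun j _ => ((hψT j).const_mul _).mul (measurable_E (by simp))
  have hr₃ : ∀ i, Measurable[M.sigmaOf (Set.range .response)ᶜ] fun ω => r₃ ω i := fun i =>
    Finset.measurable_sum _ fun j _ => (measurable_X hM (by simp) (by simp) (by simp)).mul
      (measurable_eTest (by simp))
  have hm : M.sigmaExcept (insert .testLatent (Set.range .response)) ≤ m0 := sigmaOf_le hM _
  have hm' : M.sigmaExcept (Set.range .testNoise ∪ Set.range .response) ≤ m0 := sigmaOf_le hM _
  set R₁ := condLExp
    (M.sigmaExcept (insert .testLatent (Set.range .response))) P fun ω => ENNReal.ofReal (∑ i, M.kernelDev P ω i ^ 2)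
  set R₂ := condLExp
    (M.sigmaExcept (insert .testLatent (Set.range .response))) P fun ω => ENNReal.ofReal (∑ i, r₂ ω i ^ 2)
  set R₃ := condLExp
    (M.sigmaExcept (Set.range .testNoise ∪ Set.range .response)) P fun ω => ENNReal.ofReal (∑ i, r₃ ω i ^ 2)
  have hR₁ : ∫⁻ ω, R₁ ω ∂P ≤ ENNReal.ofReal (n * (M.v₁ P / p)) :=
    lintegral_condLExp_sum_sq_le _ hm (fun i => (hr₁ i).mono h𝒢 le_rfl) fun i =>
      lintegral_kernelDev_sq_le hM hc hb hc0 i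
  have hR₂ : ∫⁻ ω, R₂ ω ∂P ≤ ENNReal.ofReal (n * M.v₂ P) :=
    lintegral_condLExp_sum_sq_le _ hm (fun i => (hr₂ i).mono h𝒢 le_rfl) fun i =>
      lintegral_noise_sq_le hM hp hb i
  have hR₃ : ∫⁻ ω, R₃ ω ∂P ≤ ENNReal.ofReal (n * (p * (M.v₂ P + M.σx ^ 2))) :=
    lintegral_condLExp_sum_sq_le _ hm' (fun i => (hr₃ i).mono h𝒢 le_rfl) fun i =>
      lintegral_test_noise_sq_le hM hp hb i
  set β : Ω → ℝ≥0∞ := fun ω => ENNReal.ofReal (specNorm (M.A ω)⁻¹ ^ 2 * (n * G + M.σy ^ 2))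
  have hEz := ae_expands_z hM hp hb heig hdecay
  have hET := ae_expands_zTest hM hp hb heig hdecay
  have hmer := ae_mercer hM hp hb heig hdecay
  have hS₁ : ∀ᵐ ω ∂P, M.S₁ P lam u ω ≤ β ω * R₁ ω := by
    have e : (fun ω => ‖M.gramForm lam u (fun k => feat lam u k (M.zTest ω))
        (M.thetaHat lam u ω) ω‖ₑ ^ 2) =ᵐ[P] fun ω => ‖M.kernelDev P ω ⬝ᵥ M.dual ω‖ₑ ^ 2 := by
      filter_upwards [hEz, hET, hmer] with ω h1 h2 h3
      rw [gramForm_thetaHat heig h2 h1 h3]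
    filter_upwards [condLExp_congr_ae
      (mΩ := M.sigmaExcept (insert .testLatent (Set.range .response))) e, condLExp_sq_dual_le hM hgm hgG
      (T := insert .testLatent (Set.range .response)) (by simp) (by simp) (by simp) (by simp) hr₁]
      with ω h1 h2
    exact h1.trans_le h2
  have hS₂ : ∀ᵐ ω ∂P, M.S₂ P lam u ω ≤ ENNReal.ofReal (M.σx ^ 2 / p) * (β ω * R₂ ω) := by
    have e : (fun ω => ‖M.Wfeat lam u (M.zTest ω) ω ⬝ᵥ ((M.Emat ω)ᵀ *ᵥ M.dual ω)‖ₑ ^ 2) =ᵐ[P]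
        fun ω => ‖r₂ ω ⬝ᵥ M.dual ω‖ₑ ^ 2 := by
      filter_upwards [hET] with ω h2
      rw [Wfeat_dotProduct heig h2]
    filter_upwards [condLExp_congr_ae
      (mΩ := M.sigmaExcept (insert .testLatent (Set.range .response))) e, condLExp_sq_dual_le hM hgm hgG
      (T := insert .testLatent (Set.range .response)) (by simp) (by simp) (by simp) (by simp) hr₂]
      with ω h1 h2
    exact mul_le_mul_right (h1.trans_le h2) _
  have hS₃ : ∀ᵐ ω ∂P, M.S₃ P ω ≤ ENNReal.ofReal (M.σx ^ 2 / (p : ℝ) ^ 2) * (β ω * R₃ ω) := by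
    have e : (fun ω => ‖(fun j => M.eTest j ω) ⬝ᵥ ((M.X ω)ᵀ *ᵥ M.dual ω)‖ₑ ^ 2) =
        fun ω => ‖r₃ ω ⬝ᵥ M.dual ω‖ₑ ^ 2 := by
      ext ω
      rw [eTest_dotProduct]
    filter_upwards [condLExp_sq_dual_le hM hgm hgG
      (T := Set.range .testNoise ∪ Set.range .response) (by simp) (by simp) (by simp) (by simp)
      hr₃] with ω h2
    rw [S₃, e]
    exact mul_le_mul_right h2 _
  set Q : Set Ω := {ω | (M.S₁ P lam u ω ≤ β ω * R₁ ω ∧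
    M.S₂ P lam u ω ≤ ENNReal.ofReal (M.σx ^ 2 / p) * (β ω * R₂ ω) ∧
    M.S₃ P ω ≤ ENNReal.ofReal (M.σx ^ 2 / (p : ℝ) ^ 2) * (β ω * R₃ ω)) ∧
    M.covX ω = M.K lam u ω + M.σx ^ 2 • (1 : Matrix (Fin n) (Fin n) ℝ) + M.Delta lam u ω}
  have hQ : P Qᶜ = 0 := by
    refine mem_ae_iff.1 ?_
    filter_upwards [hS₁, hS₂, hS₃, hEz] with ω h1 h2 h3 h4
    exact ⟨⟨h1, h2, h3⟩, covX_eq hp hb heig h4⟩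
  -- The exceptional null set need not be measurable, so a measurable null set containing it is
  -- removed.
  set N₀ := toMeasurable P Qᶜ
  set N₁ := {ω | ENNReal.ofReal (n * (M.v₁ P / p) / δ₁) < R₁ ω}
  set N₂ := {ω | ENNReal.ofReal (n * M.v₂ P / δ₂) < R₂ ω}
  set N₃ := {ω | ENNReal.ofReal (n * (p * (M.v₂ P + M.σx ^ 2)) / δ₃) < R₃ ω}
  have hN₀ : P.real N₀ = 0 := by simp [N₀, Measure.real, measure_toMeasurable, hQ]
  have hreal : ∀ {s : Set Ω} {δ : ℝ}, 0 < δ → P s ≤ ENNReal.ofReal δ → P.real s ≤ δ :=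
    fun hδ h => ENNReal.toReal_le_of_le_ofReal hδ.le h
  have hN₁ : P.real N₁ ≤ δ₁ :=
    hreal hδ₁ (measure_gt_div_le (measurable_condLExp' _ P _) hδ₁ hR₁)
  have hN₂ : P.real N₂ ≤ δ₂ :=
    hreal hδ₂ (measure_gt_div_le (measurable_condLExp' _ P _) hδ₂ hR₂)
  have hN₃ : P.real N₃ ≤ δ₃ :=
    hreal hδ₃ (measure_gt_div_le (measurable_condLExp' _ P _) hδ₃ hR₃)
  have hmeas : MeasurableSet (N₀ ∪ N₁ ∪ N₂ ∪ N₃) :=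
    (((measurableSet_toMeasurable P _).union
      (measurableSet_lt measurable_const (measurable_condLExp' _ P _))).union
      (measurableSet_lt measurable_const (measurable_condLExp' _ P _))).union
      (measurableSet_lt measurable_const (measurable_condLExp' _ P _))
  refine ⟨(N₀ ∪ N₁ ∪ N₂ ∪ N₃)ᶜ, hmeas.compl, ?_, fun ω hω => ?_⟩
  · rw [probReal_compl_eq_one_sub hmeas]
    have h1 := measureReal_union_le (μ := P) (N₀ ∪ N₁ ∪ N₂) N₃
    have h2 := measureReal_union_le (μ := P) (N₀ ∪ N₁) N₂
    have h3 := measureReal_union_le (μ := P) N₀ N₁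
    linarith
  simp only [Set.mem_compl_iff, Set.mem_union, not_or] at hω
  obtain ⟨⟨⟨h0, h1⟩, h2⟩, h3⟩ := hω
  have hωQ : ω ∈ Q := by
    by_contra h
    exact h0 (subset_toMeasurable P _ h)
  obtain ⟨⟨hs1, hs2, hs3⟩, hcov⟩ := hωQ
  refine ⟨hcov, ?_⟩
  simp only [N₁, N₂, N₃, Set.mem_ofPred_eq, not_lt] at h1 h2 h3
  have hv₁ : 0 ≤ M.v₁ P := v₁_nonneg
  have hv₂ : 0 ≤ M.v₂ P := v₂_nonneg
  have hn' : (n : ℝ) ≠ 0 := by positivity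
  have hp' : (p : ℝ) ≠ 0 := by positivity
  -- The prefactors `1`, `σx²/p` and `σx²/p²` bring the three Markov bounds to the common factor `n
  -- / p`; the other `n` comes from `nG + σy² = n (G + σy²/n)`.
  calc M.S₁ P lam u ω + M.S₂ P lam u ω + M.S₃ P ω
      ≤ β ω * ENNReal.ofReal (n * (M.v₁ P / p) / δ₁) +
        ENNReal.ofReal (M.σx ^ 2 / p) * (β ω * ENNReal.ofReal (n * M.v₂ P / δ₂)) +
        ENNReal.ofReal (M.σx ^ 2 / (p : ℝ) ^ 2) *
          (β ω * ENNReal.ofReal (n * (p * (M.v₂ P + M.σx ^ 2)) / δ₃)) := by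
        refine add_le_add (add_le_add (hs1.trans ?_) (hs2.trans ?_)) (hs3.trans ?_) <;> gcongr
    _ = ENNReal.ofReal (specNorm (M.A ω)⁻¹ ^ 2 * M.boundNumerator P δ₁ δ₂ δ₃) := by
        simp only [β]
        rw [← ENNReal.ofReal_mul (by positivity), ← ENNReal.ofReal_mul (by positivity),
          ← ENNReal.ofReal_mul (by positivity), ← ENNReal.ofReal_mul (by positivity),
          ← ENNReal.ofReal_mul (by positivity), ← ENNReal.ofReal_add (by positivity)
          (by positivity), ← ENNReal.ofReal_add (by positivity) (by positivity)]
        congr 1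
        have hG : (⨆ z, |M.g z| ^ 2) = G := rfl
        rw [boundNumerator, hG]
        field_simp

end Model

end LMM

end

/-! ### The two bounds. -/

theorem theorem3 {Ω Z : Type*} [MeasurableSpace Ω] [MetricSpace Z] [CompactSpace Z]
    [MeasurableSpace Z] [BorelSpace Z] (P : Measure Ω) [IsProbabilityMeasure P]
    {n p : ℕ} (hn : 0 < n) (hp : 0 < p) (M : LMM.Model Ω Z n p)
    (hM : M.IsLMM P) (hcont : M.MeanSquareContinuous P) (hmom : M.FourthMoments P)
    (lam : ℕ → ℝ) (u : ℕ → Z → ℝ) (heig : M.IsEigensystem P lam u)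
    (hdecay : Summable (fun k : ℕ => ((k : ℝ) + 1) * lam k))
    (hg : M.RegressionInRange lam u)
    (δ₁ δ₂ δ₃ : ℝ) (hδ₁ : 0 < δ₁) (hδ₂ : 0 < δ₂) (hδ₃ : 0 < δ₃) :
    (∃ G : Set Ω, MeasurableSet G ∧ 1 - (δ₁ + δ₂ + δ₃) ≤ P.real G ∧
      ∀ ω ∈ G, 0 < LMM.eigval n (M.covX ω) + n * M.γ →
        IsUnit (M.A ω).det ∧
        M.S₁ P lam u ω + M.S₂ P lam u ω + M.S₃ P ω ≤
          ENNReal.ofReal (M.boundNumerator P δ₁ δ₂ δ₃ /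
            (LMM.eigval n (M.covX ω) + n * M.γ) ^ 2)) ∧
    (∃ G : Set Ω, MeasurableSet G ∧
      1 - (δ₁ + δ₂ + δ₃) - P.real (M.C lam u) - P.real (M.D lam u) ≤ P.real G ∧
      ∀ ω ∈ G, 0 < LMM.eigval n (M.K lam u ω) + M.σx ^ 2 + n * M.γ ∧
        IsUnit (M.A ω).det ∧
        M.S₁ P lam u ω + M.S₂ P lam u ω + M.S₃ P ω ≤
          ENNReal.ofReal (4 * M.boundNumerator P δ₁ δ₂ δ₃ /
            (LMM.eigval n (M.K lam u ω) + M.σx ^ 2 + n * M.γ) ^ 2)) := by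
  have : IsProbabilityMeasure M.μ :=
    hM.zTest_law ▸ Measure.isProbabilityMeasure_map hM.zTest_meas.aemeasurable
  obtain ⟨G, hGm, hGP, hG⟩ :=
    LMM.Model.exists_event_residual_le hn hp hM hmom heig hdecay hg hδ₁ hδ₂ hδ₃
  have hbn : 0 ≤ M.boundNumerator P δ₁ δ₂ δ₃ := LMM.Model.boundNumerator_nonneg hδ₁ hδ₂ hδ₃
  -- Both claims are instances of this one, with different lower bounds `c` for the quadratic form
  -- of `A`.
  have key : ∀ ω ∈ G, ∀ c : ℝ, 0 < c →
      (∀ x : Fin n → ℝ, c * ∑ i, x i ^ 2 ≤ x ⬝ᵥ (M.A ω *ᵥ x)) → IsUnit (M.A ω).det ∧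
        M.S₁ P lam u ω + M.S₂ P lam u ω + M.S₃ P ω ≤
          ENNReal.ofReal (M.boundNumerator P δ₁ δ₂ δ₃ / c ^ 2) := by
    intro ω hω c hc hx
    obtain ⟨h1, h2⟩ := LMM.isUnit_det_and_specNorm_inv_le hc hx
    refine ⟨h1, (hG ω hω).2.trans (ENNReal.ofReal_le_ofReal ?_)⟩
    rw [div_eq_inv_mul, ← inv_pow]
    exact mul_le_mul_of_nonneg_right (pow_le_pow_left₀ (norm_nonneg _) h2 2) hbn
  have hself : ∀ x : Fin n → ℝ, x ⬝ᵥ x = ∑ i, x i ^ 2 := fun x => by simp [dotProduct, sq]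
  refine ⟨⟨G, hGm, hGP, fun ω hω hc => key ω hω _ hc fun x => ?_⟩, ?_⟩
  · have h1 := LMM.eigval_mul_sum_sq_le (LMM.Model.isHermitian_covX M ω) hn x
    rw [LMM.Model.A, Matrix.add_mulVec, dotProduct_add, Matrix.smul_mulVec, Matrix.one_mulVec,
      dotProduct_smul, hself, smul_eq_mul, add_mul]
    linarith
  -- Measurable hulls replace `C` and `D` at no cost in probability and make the final event
  -- measurable.
  · refine ⟨G \ (toMeasurable P (M.C lam u) ∪ toMeasurable P (M.D lam u)), hGm.diff
      ((measurableSet_toMeasurable _ _).union (measurableSet_toMeasurable _ _)), ?_,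
      fun ω hω => ?_⟩
    · have h1 := measureReal_union_le (μ := P) (toMeasurable P (M.C lam u))
        (toMeasurable P (M.D lam u))
      have h2 := le_measureReal_sdiff (μ := P) (s₁ := G) (s₂ := toMeasurable P (M.C lam u) ∪
        toMeasurable P (M.D lam u))
      simp only [Measure.real, measure_toMeasurable] at h1 h2 hGP ⊢
      linarith
    · obtain ⟨hωG, hωN⟩ := hω
      have hωC : ω ∉ M.C lam u := fun h => hωN (Or.inl (subset_toMeasurable P _ h))
      simp only [LMM.Model.C, Set.mem_ofPred_eq, ge_iff_le, not_le] at hωC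
      set τ := LMM.eigval n (M.K lam u ω) + M.σx ^ 2 + n * M.γ with hτ
      have h0 : 0 ≤ LMM.specNorm (M.Delta lam u ω) := norm_nonneg _
      have hτ0 : 0 < τ := by linarith
      refine ⟨hτ0, ?_⟩
      -- Outside `C`, `‖Δ‖ < τ / 2`, so the form of `A` is bounded below by `τ - ‖Δ‖ ≥ τ / 2`;
      -- squaring the half produces the factor `4`.
      have h4 : 4 * M.boundNumerator P δ₁ δ₂ δ₃ / τ ^ 2 =
          M.boundNumerator P δ₁ δ₂ δ₃ / (τ / 2) ^ 2 := by field_simp; ring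
      rw [h4]
      refine key ω hωG _ (by positivity) fun x => ?_
      have h1 := LMM.eigval_mul_sum_sq_le (LMM.Model.isHermitian_K M lam u ω) hn x
      have h2 := (abs_le.1 (LMM.abs_dotProduct_mulVec_le (M.Delta lam u ω) x)).1
      have h3 : 0 ≤ ∑ i, x i ^ 2 := Finset.sum_nonneg fun _ _ => sq_nonneg _
      rw [LMM.Model.A, (hG ω hωG).1, Matrix.add_mulVec, Matrix.add_mulVec, Matrix.add_mulVec,
        dotProduct_add, dotProduct_add, dotProduct_add, Matrix.smul_mulVec, Matrix.smul_mulVec,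
        Matrix.one_mulVec, dotProduct_smul, dotProduct_smul, hself, smul_eq_mul, smul_eq_mul]
      have h5 : LMM.specNorm (M.Delta lam u ω) * ∑ i, x i ^ 2 ≤ τ / 2 * ∑ i, x i ^ 2 :=
        mul_le_mul_of_nonneg_right (by linarith) h3
      have h6 : τ * ∑ i, x i ^ 2 = LMM.eigval n (M.K lam u ω) * ∑ i, x i ^ 2 +
          M.σx ^ 2 * ∑ i, x i ^ 2 + n * M.γ * ∑ i, x i ^ 2 := by rw [hτ]; ring
      linarith
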